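/- For $n\ge 0$ let $Q_n$ be the $n$-dimensional hypercube: the graph with vertex set $\mathbb{F}_2^n$ in which two vertices are adjacent if and only if they differ in exactly one coordinate. An edge-coloring of a graph is proper if distinct edges sharing a vertex have distinct colors. For a graph $G$ with an edge-coloring, a rainbow copy of a graph $H$ in $G$ is an injective map $V(H)\to V(G)$ that sends edges of $H$ to edges of $G$, and distinct edges of $H$ to edges with distinct colors. Let $\delta(G)$ be the minimum degree of $G$. All trees and graphs below are finite. Theorem. Let $n\ge 0$. (1) Let $G$ be a subgraph of $Q_n$ with at least one vertex, with a proper edge-coloring (with colors from an arbitrary set). Then for every tree $T$ with at most $\delta(G)$ edges there is a rainbow copy of $T$ in $G$. (2) In particular, every proper edge-coloring of $Q_n$ contains a rainbow copy of every tree with at most $n$ edges. (3) The bound is sharp: $\delta(Q_n)=n$, and the Cayley coloring of $Q_n$, in which an edge whose endpoints differ in the $i$-th coordinate gets color $i$, is proper, uses exactly the $n$ colors $1,\dots,n$, and contains no rainbow cycle $C_k$ for any $k\ge 3$; since it has only $n$ colors, it contains no rainbow copy of any graph with more than $n$ edges (in particular of any tree with more than $n$ edges). -/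

import Mathlib

universe u v

namespace RainbowTree

/-- The `n`-dimensional hypercube `Q_n`: the vertices are the elements of `𝔽₂ⁿ`, and two vertices
are adjacent iff they differ in exactly one coordinate. -/
def hypercube (n : ℕ) : SimpleGraph (Fin n → ZMod 2) where
  Adj x y := ∃! i, x i ≠ y i
  symm := ⟨fun x y h => by simpa only [ne_comm] using h⟩
  loopless := ⟨fun x h => by obtain ⟨i, hi, -⟩ := h; exact hi rfl⟩

instance (n : ℕ) : DecidableRel (hypercube n).Adj :=
  fun x y => inferInstanceAs (Decidable (∃ i, x i ≠ y i ∧ ∀ j, x j ≠ y j → j = i))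

variable {V C : Type*} {G : SimpleGraph V}

/-- An edge-coloring is proper if any two distinct edges sharing a vertex have distinct colors. -/
def IsProper (c : G.EdgeLabeling C) : Prop :=
  ∀ e₁ e₂ : G.edgeSet, e₁ ≠ e₂ → (∃ v, v ∈ (e₁ : Sym2 V) ∧ v ∈ (e₂ : Sym2 V)) → c e₁ ≠ c e₂

/-- A rainbow copy of `H` in the graph `G` edge-colored by `c`: an injective graph homomorphism
from `H` to `G` that sends distinct edges of `H` to edges of distinct colors. -/
def HasRainbowCopy {W : Type*} (H : SimpleGraph W) (c : G.EdgeLabeling C) : Prop :=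
  ∃ f : H.Copy G, Function.Injective fun e : H.edgeSet => c (f.toHom.mapEdgeSet e)

/-- The Cayley coloring of `Q_n`: an edge whose endpoints differ in coordinate `i` gets color
`i`. -/
noncomputable def cayleyColoring (n : ℕ) : (hypercube n).EdgeLabeling (Fin n) :=
  SimpleGraph.EdgeLabeling.mk (fun _ _ h => h.choose) fun _ _ h =>
    h.choose_spec.2 _ (h.symm.choose_spec.1.symm)

theorem cayleyColoring_get_eq_iff {n : ℕ} {x y : Fin n → ZMod 2} (h : (hypercube n).Adj x y)
    (i : Fin n) : (cayleyColoring n).get x y h = i ↔ x i ≠ y i := by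
  have hc : (cayleyColoring n).get x y h = h.choose := rfl
  rw [hc]
  exact ⟨fun e => e ▸ h.choose_spec.1, fun hi => (h.choose_spec.2 i hi).symm⟩

end RainbowTree

set_option linter.unusedSectionVars false

/-! ### Rooted trees: descendants, branches, heights -/

namespace RainbowTree

/-! Root the tree and give each non-root vertex t the direction `g t` of the cube edge from its
parent. Let k be the minimum degree, so that the tree has at most k + 1 vertices. Once a rooted
subtree P is placed, #P - 1 colors are taken, so a next vertex, whose parent has at least k
directions, can be placed rainbow and outside any set A of directions with #P + #A ≤ k
(`Good.place`). Directions of edges already placed at the parent are avoided for free, since their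
colors are taken. The difficulty is injectivity: it is enforced by forbidding directions, and the
unplaced vertices are the budget that pays for this.

The top half of the branch at s consists of the vertices whose depth below s is at most their
height. It has at most half of the branch, rounded up (`two_mul_card_top_le`), and every vertex of
the branch is a descendant of some u in it, at distance at most one more than the depth of u below s
(`exists_top`). Let s be a child of r. Place the top half of s with distinct directions, then the
other branches at r without these directions. A vertex b of those branches agrees with r in all
coordinates used by the top half, so its distance from u exceeds the depth of u below r; hence
nothing placed below u in the branch of s can reach b. The rest of this branch is completed by
induction, with s in the role of r (`Completable.finish`). To keep it away from its ancestors and to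
serve the same argument higher up, the induction statement `Completable` also carries a walk Δ from
r to be avoided, in use a part of the path towards the root, and a set Φ of forbidden directions.

Forbidding the directions of the top half is paid for by the unplaced rest of the branch, unless the
branch is tight, that is, its top half is larger than the rest. If there are several branches and
all are tight, the budget is one short. But tightness improves the distance bound above by one
(`exists_top_of_tight`), so that only the top halves of the other branches must avoid the directions
of the top half of s (`lt_hammingDist_of_tight`). These other branches are kept apart from each
other by reserving the directions of their roots (`Completable.finish_branches`).

For sharpness, a color i that occurs once on a cycle would make coordinate i change exactly once
around it; graphs with more than n edges run out of colors. -/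

/-- A finite rooted tree, given by its parent and depth functions. -/
structure ParentTree (V : Type*) where
  root : V
  par : V → V
  dep : V → ℕ
  par_root : par root = root
  dep_root : dep root = 0
  dep_par : ∀ t, t ≠ root → dep t = dep (par t) + 1

namespace ParentTree

open Finset

variable {V : Type*} [Fintype V] [DecidableEq V] (T : ParentTree V)

/-- The descendants of `s`, including `s` itself. -/
noncomputable def dsc (s : V) : Finset V := by
  classical exact univ.filter fun t => ∃ m, T.par^[m] t = s

/-- The children of `s`. -/
def ch (s : V) : Finset V := univ.filter fun t => t ≠ T.root ∧ T.par t = s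

/-- The height of the subtree rooted at `s`. -/
noncomputable def height (s : V) : ℕ := (T.dsc s).sup fun t => T.dep t - T.dep s

/-- The union of the branches rooted at the elements of `C`. -/
noncomputable def branches (C : Finset V) : Finset V := C.biUnion T.dsc

/-- The descendants `t` of `s` with `dep t - dep s + m ≤ height t + 1`. -/
noncomputable def upper (m : ℕ) (s : V) : Finset V :=
  (T.dsc s).filter fun t => T.dep t + m ≤ T.height t + 1 + T.dep s

variable {T} {s t u c r : V}

theorem mem_dsc : t ∈ T.dsc s ↔ ∃ m, T.par^[m] t = s := by simp [dsc]

theorem mem_ch : c ∈ T.ch s ↔ c ≠ T.root ∧ T.par c = s := by simp [ch]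

theorem mem_branches {C : Finset V} : t ∈ T.branches C ↔ ∃ s ∈ C, t ∈ T.dsc s := by
  simp [branches]

theorem self_mem_dsc (s : V) : s ∈ T.dsc s := mem_dsc.2 ⟨0, rfl⟩

theorem dsc_trans (h : t ∈ T.dsc u) (h' : u ∈ T.dsc s) : t ∈ T.dsc s := by
  obtain ⟨m, hm⟩ := mem_dsc.1 h
  obtain ⟨l, hl⟩ := mem_dsc.1 h'
  exact mem_dsc.2 ⟨l + m, by rw [Function.iterate_add_apply, hm, hl]⟩

theorem dsc_of_par (h : T.par t ∈ T.dsc s) : t ∈ T.dsc s :=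
  dsc_trans (mem_dsc.2 ⟨1, rfl⟩) h

theorem par_mem_dsc (h : t ∈ T.dsc s) (hne : t ≠ s) : T.par t ∈ T.dsc s := by
  obtain ⟨m, hm⟩ := mem_dsc.1 h
  cases m with
  | zero => exact absurd hm hne
  | succ m => exact mem_dsc.2 ⟨m, by simpa [Function.iterate_succ_apply] using hm⟩

theorem dep_ch (h : c ∈ T.ch s) : T.dep c = T.dep s + 1 := by
  obtain ⟨h1, rfl⟩ := mem_ch.1 h
  exact T.dep_par _ h1

theorem ne_root_of_mem_dsc_ne (h : t ∈ T.dsc s) (hne : t ≠ s) : t ≠ T.root := by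
  rintro rfl
  obtain ⟨m, hm⟩ := mem_dsc.1 h
  exact hne (by rw [← hm, Function.iterate_fixed T.par_root])

theorem dsc_induction {p : V → Prop} (h0 : p s)
    (hs : ∀ t ∈ T.dsc s, t ≠ s → t ≠ T.root → p (T.par t) → p t) : ∀ t ∈ T.dsc s, p t := by
  have key : ∀ m t, T.par^[m] t = s → p t := by
    intro m
    induction m with
    | zero => rintro t rfl; exact h0
    | succ m ih =>
      intro t ht
      by_cases hts : t = s
      · exact hts ▸ h0
      · have hd : t ∈ T.dsc s := mem_dsc.2 ⟨_, ht⟩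
        exact hs t hd hts (ne_root_of_mem_dsc_ne hd hts) (ih _ ht)
  intro t ht
  obtain ⟨m, hm⟩ := mem_dsc.1 ht
  exact key m t hm

theorem dep_le (h : t ∈ T.dsc s) : T.dep s ≤ T.dep t := by
  refine dsc_induction (p := fun t => T.dep s ≤ T.dep t) le_rfl ?_ t h
  intro t _ _ h2 h3
  have := T.dep_par t h2
  omega

theorem dep_lt (h : t ∈ T.dsc s) (hne : t ≠ s) : T.dep s < T.dep t := by
  have := dep_le (par_mem_dsc h hne)
  have := T.dep_par t (ne_root_of_mem_dsc_ne h hne)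
  omega

theorem dsc_ch (h : c ∈ T.ch s) : c ∈ T.dsc s :=
  dsc_of_par (by rw [(mem_ch.1 h).2]; exact self_mem_dsc s)

theorem mem_dsc_root (t : V) : t ∈ T.dsc T.root := by
  have : ∀ n t, T.dep t = n → t ∈ T.dsc T.root := by
    intro n
    induction n with
    | zero =>
      intro t ht
      by_cases h : t = T.root
      · exact h ▸ self_mem_dsc _
      · have := T.dep_par t h; omega
    | succ n ih =>
      intro t ht
      by_cases h : t = T.root
      · exact h ▸ self_mem_dsc _
      · have := T.dep_par t h
        exact dsc_of_par (ih _ (by omega))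
  exact this _ t rfl

theorem eq_of_mem_dsc (h : t ∈ T.dsc s) (h' : t ∈ T.dsc u) (hd : T.dep s = T.dep u) : s = u := by
  revert h'
  refine dsc_induction (p := fun t => t ∈ T.dsc u → s = u) ?_ ?_ t h
  · intro h'
    by_contra hne
    have := dep_lt h' hne
    omega
  · intro t ht hne _ ih htu
    refine ih (par_mem_dsc htu ?_)
    rintro rfl
    have := dep_lt ht hne
    omega

theorem disjoint_dsc (h : s ∈ T.ch r) (h' : u ∈ T.ch r) (hne : s ≠ u) :
    Disjoint (T.dsc s) (T.dsc u) := by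
  rw [Finset.disjoint_left]
  intro t ht ht'
  exact hne (eq_of_mem_dsc ht ht' (by rw [dep_ch h, dep_ch h']))

theorem mem_branches_ch : t ∈ T.branches (T.ch s) ↔ t ∈ T.dsc s ∧ t ≠ s := by
  constructor
  · intro h
    obtain ⟨c, hc, ht⟩ := mem_branches.1 h
    refine ⟨dsc_trans ht (dsc_ch hc), ?_⟩
    rintro rfl
    have := dep_le ht
    have := dep_ch hc
    omega
  · rintro ⟨h, hne⟩
    revert hne
    refine dsc_induction (p := fun t => t ≠ s → t ∈ T.branches (T.ch s)) (fun h => absurd rfl h) ?_ t h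
    intro t ht hne hr ih _
    by_cases hp : T.par t = s
    · exact mem_branches.2 ⟨t, mem_ch.2 ⟨hr, hp⟩, self_mem_dsc t⟩
    · obtain ⟨c, hc, htc⟩ := mem_branches.1 (ih hp)
      exact mem_branches.2 ⟨c, hc, dsc_of_par htc⟩

theorem dsc_eq_insert (s : V) : T.dsc s = insert s (T.branches (T.ch s)) := by
  ext t
  rw [mem_insert, mem_branches_ch]
  by_cases h : t = s
  · simp [h, self_mem_dsc]
  · simp [h]

theorem notMem_branches_ch (s : V) : s ∉ T.branches (T.ch s) := fun h =>
  (mem_branches_ch.1 h).2 rfl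

theorem card_dsc (s : V) : #(T.dsc s) = 1 + ∑ c ∈ T.ch s, #(T.dsc c) := by
  rw [dsc_eq_insert, card_insert_of_notMem (notMem_branches_ch s), branches, card_biUnion]
  · ring
  · intro x hx y hy hne
    exact disjoint_dsc hx hy hne

theorem dep_le_height (h : t ∈ T.dsc s) : T.dep t ≤ T.height s + T.dep s := by
  have := Finset.le_sup (f := fun t => T.dep t - T.dep s) h
  simp only [height] at *
  omega

theorem dep_add_height_le (h : t ∈ T.dsc s) :
    T.dep t + T.height t ≤ T.height s + T.dep s := by
  have h2 : T.height t ≤ T.height s + T.dep s - T.dep t := by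
    refine Finset.sup_le fun w hw => ?_
    have := dep_le_height (dsc_trans hw h)
    omega
  have := dep_le_height h
  omega

theorem exists_dep_eq_height (s : V) : ∃ t ∈ T.dsc s, T.dep t = T.height s + T.dep s := by
  obtain ⟨t, ht, h⟩ := Finset.exists_mem_eq_sup (T.dsc s) ⟨s, self_mem_dsc s⟩
    (fun t => T.dep t - T.dep s)
  refine ⟨t, ht, ?_⟩
  have := dep_le ht
  simp only [height]
  omega

theorem height_lt_card (s : V) : T.height s + 1 ≤ #(T.dsc s) := by
  obtain ⟨t, ht, h⟩ := T.exists_dep_eq_height s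
  have key : ∀ t ∈ T.dsc s, ∀ d, T.dep s ≤ d → d ≤ T.dep t → ∃ w ∈ T.dsc s, T.dep w = d := by
    refine dsc_induction (fun d h1 h2 => ⟨s, self_mem_dsc s, by omega⟩) ?_
    intro t ht hne hr ih d h1 h2
    by_cases hd : d = T.dep t
    · exact ⟨t, ht, hd.symm⟩
    · exact ih d h1 (by have := T.dep_par t hr; omega)
  have hsub : Finset.Icc (T.dep s) (T.dep t) ⊆ (T.dsc s).image T.dep := by
    intro d hd
    rw [Finset.mem_Icc] at hd
    obtain ⟨w, hw, h⟩ := key t ht d hd.1 hd.2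
    exact mem_image.2 ⟨w, hw, h⟩
  have := (card_le_card hsub).trans card_image_le
  rw [Nat.card_Icc] at this
  omega

theorem one_le_height (h : 1 < #(T.dsc s)) : 1 ≤ T.height s := by
  obtain ⟨t, ht, hne⟩ := Finset.exists_mem_ne h s
  have := dep_lt ht hne
  have := dep_le_height ht
  omega

theorem height_par (h : t ∈ T.dsc s) (hne : t ≠ s) : T.height t + 1 ≤ T.height (T.par t) := by
  have := dep_add_height_le (T := T) (dsc_of_par (self_mem_dsc (T.par t)))
  have := T.dep_par t (ne_root_of_mem_dsc_ne h hne)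
  omega

/-! ### Counting the upper vertices of a branch -/

theorem mem_upper {m : ℕ} :
    t ∈ T.upper m s ↔ t ∈ T.dsc s ∧ T.dep t + m ≤ T.height t + 1 + T.dep s := by
  simp [upper]

theorem upper_subset {m : ℕ} : T.upper m s ⊆ T.dsc s := filter_subset _ _

theorem le_of_mem_upper {m : ℕ} (h : t ∈ T.upper m s) : m ≤ T.height s + 1 := by
  obtain ⟨h1, h2⟩ := mem_upper.1 h
  have := dep_add_height_le h1
  have := dep_le h1
  omega

theorem upper_eq_empty {m : ℕ} (h : T.height s + 1 < m) : T.upper m s = ∅ := by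
  refine Finset.eq_empty_of_forall_notMem fun t ht => ?_
  have := le_of_mem_upper ht
  omega

theorem card_upper {m : ℕ} (h : m ≤ T.height s + 1) :
    #(T.upper m s) = 1 + ∑ c ∈ T.ch s, #(T.upper (m + 1) c) := by
  have : T.upper m s = insert s ((T.ch s).biUnion (T.upper (m + 1))) := by
    ext t
    rw [mem_insert, mem_biUnion, mem_upper]
    constructor
    · rintro ⟨h1, h2⟩
      by_cases hts : t = s
      · exact Or.inl hts
      · obtain ⟨c, hc, htc⟩ := mem_branches.1 (mem_branches_ch.2 ⟨h1, hts⟩)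
        have := dep_ch hc
        exact Or.inr ⟨c, hc, mem_upper.2 ⟨htc, by omega⟩⟩
    · rintro (rfl | ⟨c, hc, ht⟩)
      · exact ⟨self_mem_dsc t, by omega⟩
      · have := dep_ch hc
        obtain ⟨h1, h2⟩ := mem_upper.1 ht
        exact ⟨dsc_trans h1 (dsc_ch hc), by omega⟩
  rw [this, card_insert_of_notMem, card_biUnion]
  · ring
  · intro x hx y hy hne
    exact (disjoint_dsc hx hy hne).mono upper_subset upper_subset
  · intro hs
    obtain ⟨c, hc, h⟩ := mem_biUnion.1 hs
    have := dep_le (upper_subset h)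
    have := dep_ch hc
    omega

theorem card_dsc_lt (h : c ∈ T.ch s) : #(T.dsc c) < #(T.dsc s) := by
  rw [card_dsc s]
  have := Finset.single_le_sum (f := fun c => #(T.dsc c)) (fun _ _ => Nat.zero_le _) h
  omega

/-- Induction over the children c, using `upper (m + 1) c`. A child of height at least m contributes
the gain m + 1, which covers s itself, and the other children lose nothing because m + 1 ≥ 2. If
there is no such child, only s is upper and the height bounds the size of the branch from below. -/
theorem two_mul_card_upper_le {m : ℕ} (hm : 1 ≤ m) (h : m ≤ T.height s + 1) :
    2 * #(T.upper m s) + m ≤ #(T.dsc s) + 2 := by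
  induction hN : #(T.dsc s) using Nat.strong_induction_on generalizing s m with
  | _ N ih =>
  subst hN
  have hle : ∀ c ∈ T.ch s, 2 * #(T.upper (m + 1) c) ≤ #(T.dsc c) := by
    intro c hc
    by_cases hu : m + 1 ≤ T.height c + 1
    · have := ih _ (card_dsc_lt hc) (by omega) hu rfl
      omega
    · simp [upper_eq_empty (not_le.1 hu)]
  rw [card_upper h, card_dsc]
  by_cases hex : ∃ c ∈ T.ch s, m + 1 ≤ T.height c + 1
  · obtain ⟨c, hc, hu⟩ := hex
    have h1 := ih _ (card_dsc_lt hc) (by omega) hu rfl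
    have h2 := Finset.sum_le_sum fun x (hx : x ∈ (T.ch s).erase c) => hle x (mem_of_mem_erase hx)
    rw [← Finset.mul_sum] at h2
    rw [← Finset.add_sum_erase _ _ hc, ← Finset.add_sum_erase (T.ch s) (fun c => #(T.dsc c)) hc]
    omega
  · have h0 : ∑ c ∈ T.ch s, #(T.upper (m + 1) c) = 0 := by
      refine Finset.sum_eq_zero fun c hc => ?_
      push Not at hex
      rw [upper_eq_empty (by have := hex c hc; omega), card_empty]
    have := T.height_lt_card s
    rw [card_dsc] at this
    omega

/-- Being outside `upper m s` gives this inequality with 2 in place of 3; equality in the count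
improves it by one. Equality passes down to all children until the branch is a path on m vertices,
where the claim is checked directly. -/
theorem lt_of_tight {m : ℕ} (hm : 1 ≤ m) (h : m ≤ T.height s + 1)
    (heq : 2 * #(T.upper m s) + m = #(T.dsc s) + 2) (ht : t ∈ T.dsc s) (htu : t ∉ T.upper m s) :
    T.height t + 3 + T.dep s ≤ T.dep t + m := by
  induction hN : #(T.dsc s) using Nat.strong_induction_on generalizing s m with
  | _ N ih =>
  subst hN
  have hts : t ≠ s := by
    rintro rfl
    exact htu (mem_upper.2 ⟨ht, by omega⟩)
  have hle : ∀ c ∈ T.ch s, 2 * #(T.upper (m + 1) c) ≤ #(T.dsc c) := by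
    intro c hc
    by_cases hu : m + 1 ≤ T.height c + 1
    · have := two_mul_card_upper_le (by omega) hu
      omega
    · simp [upper_eq_empty (not_le.1 hu)]
  obtain ⟨c, hc, htc⟩ := mem_branches.1 (mem_branches_ch.2 ⟨ht, hts⟩)
  have hdc := dep_ch hc
  have htuc : t ∉ T.upper (m + 1) c := by
    intro hu
    have := (mem_upper.1 hu).2
    exact htu (mem_upper.2 ⟨ht, by omega⟩)
  by_cases hex : ∃ c ∈ T.ch s, m + 1 ≤ T.height c + 1
  · have hc2 := heq
    rw [card_upper h, card_dsc] at hc2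
    have hsum : ∀ x ∈ T.ch s, #(T.dsc x) + 1 ≤ 2 * #(T.upper (m + 1) x) + m := by
      intro x hx
      have h2 := Finset.sum_le_sum fun y (hy : y ∈ (T.ch s).erase x) => hle y (mem_of_mem_erase hy)
      rw [← Finset.mul_sum] at h2
      rw [← Finset.add_sum_erase _ _ hx, ← Finset.add_sum_erase (T.ch s) (fun c => #(T.dsc c)) hx]
        at hc2
      omega
    -- Beside a tall child, which uses up the whole deficit m - 1, a short child with its deficit of
    -- at least 1 would break equality.
    have hcu : m + 1 ≤ T.height c + 1 := by
      by_contra hcu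
      obtain ⟨d, hd, hdu⟩ := hex
      have hne : c ≠ d := by rintro rfl; exact hcu hdu
      have h1 := two_mul_card_upper_le (T := T) (s := d) (by omega) hdu
      have h0 : #(T.upper (m + 1) c) = 0 := by
        rw [upper_eq_empty (not_le.1 hcu), card_empty]
      have h3 : 1 ≤ #(T.dsc c) := card_pos.2 ⟨c, self_mem_dsc c⟩
      have hd' : d ∈ (T.ch s).erase c := mem_erase.2 ⟨hne.symm, hd⟩
      have h2 := Finset.sum_le_sum fun y (hy : y ∈ ((T.ch s).erase c).erase d) =>
        hle y (mem_of_mem_erase (mem_of_mem_erase hy))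
      rw [← Finset.mul_sum] at h2
      rw [← Finset.add_sum_erase _ _ hc, ← Finset.add_sum_erase (T.ch s) (fun c => #(T.dsc c)) hc,
        ← Finset.add_sum_erase _ _ hd',
        ← Finset.add_sum_erase ((T.ch s).erase c) (fun c => #(T.dsc c)) hd'] at hc2
      omega
    have h1 := two_mul_card_upper_le (T := T) (s := c) (by omega) hcu
    have h2 := hsum c hc
    have := ih _ (card_dsc_lt hc) (by omega) hcu (by omega) htc htuc rfl
    omega
  · have h0 : ∑ c ∈ T.ch s, #(T.upper (m + 1) c) = 0 := by
      refine Finset.sum_eq_zero fun c hc => ?_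
      push Not at hex
      rw [upper_eq_empty (by have := hex c hc; omega), card_empty]
    rw [card_upper h, h0] at heq
    have := T.height_lt_card s
    have := dep_add_height_le ht
    have := dep_lt ht hts
    omega

/-! ### Top halves and tight branches -/

/-- The top half of the branch rooted at `s`. -/
noncomputable def top (T : ParentTree V) (s : V) : Finset V := T.upper 1 s

theorem mem_top : t ∈ T.top s ↔ t ∈ T.dsc s ∧ T.dep t ≤ T.height t + T.dep s := by
  rw [top, mem_upper]
  constructor <;> rintro ⟨h1, h2⟩ <;> exact ⟨h1, by omega⟩

theorem top_subset : T.top s ⊆ T.dsc s := upper_subset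

theorem self_mem_top (s : V) : s ∈ T.top s := mem_top.2 ⟨self_mem_dsc s, by omega⟩

theorem par_mem_top (h : t ∈ T.top s) (hne : t ≠ s) : T.par t ∈ T.top s := by
  obtain ⟨h1, h2⟩ := mem_top.1 h
  have := T.dep_par t (ne_root_of_mem_dsc_ne h1 hne)
  have := height_par h1 hne
  exact mem_top.2 ⟨par_mem_dsc h1 hne, by omega⟩

/-- A branch is tight if its top half is as large as possible. -/
def Tight (T : ParentTree V) (s : V) : Prop := #(T.dsc s) + 1 ≤ 2 * #(T.top s)

theorem two_mul_card_top_le (s : V) : 2 * #(T.top s) ≤ #(T.dsc s) + 1 := by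
  have := two_mul_card_upper_le (T := T) (s := s) (m := 1) le_rfl (by omega)
  rw [top]
  omega

theorem two_mul_card_upper_two_le (s : V) : 2 * #(T.upper 2 s) ≤ #(T.dsc s) := by
  by_cases h : 2 ≤ T.height s + 1
  · have := two_mul_card_upper_le (T := T) (s := s) (m := 2) (by omega) h
    omega
  · simp [upper_eq_empty (not_le.1 h)]

theorem mem_top_or (h : t ∈ T.dsc s) :
    t ∈ T.top s ∨ ∃ w ∈ T.dsc s, w ≠ s ∧ w ∉ T.top s ∧ T.par w ∈ T.top s ∧ t ∈ T.dsc w := by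
  refine dsc_induction (p := fun t => t ∈ T.top s ∨
    ∃ w ∈ T.dsc s, w ≠ s ∧ w ∉ T.top s ∧ T.par w ∈ T.top s ∧ t ∈ T.dsc w)
    (Or.inl (self_mem_top s)) ?_ t h
  intro t ht hne hr ih
  rcases ih with ih | ⟨w, h1, h2, h3, h4, h5⟩
  · by_cases h : t ∈ T.top s
    · exact Or.inl h
    · exact Or.inr ⟨t, ht, hne, h, ih, self_mem_dsc t⟩
  · exact Or.inr ⟨w, h1, h2, h3, h4, dsc_of_par h5⟩

/-- Outside the top half, take the first vertex w on the way down to t that leaves it, and let u be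
its parent: the height of w is less than its depth below s, which limits how far t can be. -/
theorem exists_top (h : t ∈ T.dsc s) :
    ∃ u ∈ T.top s, t ∈ T.dsc u ∧ T.dep t + T.dep s ≤ 2 * T.dep u + 1 := by
  rcases mem_top_or h with h' | ⟨w, h1, h2, h3, h4, h5⟩
  · exact ⟨t, h', self_mem_dsc t, by have := dep_le h; omega⟩
  · refine ⟨_, h4, dsc_trans h5 (dsc_of_par (self_mem_dsc _)), ?_⟩
    have := T.dep_par w (ne_root_of_mem_dsc_ne h1 h2)
    have := dep_le_height h5
    rw [mem_top] at h3
    have : ¬ T.dep w ≤ T.height w + T.dep s := fun h => h3 ⟨h1, h⟩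
    omega

theorem exists_top_of_tight (hs : T.Tight s) (h : t ∈ T.dsc s) :
    ∃ u ∈ T.top s, t ∈ T.dsc u ∧ T.dep t + T.dep s ≤ 2 * T.dep u := by
  rcases mem_top_or h with h' | ⟨w, h1, h2, h3, h4, h5⟩
  · exact ⟨t, h', self_mem_dsc t, by have := dep_le h; omega⟩
  · refine ⟨_, h4, dsc_trans h5 (dsc_of_par (self_mem_dsc _)), ?_⟩
    have := T.dep_par w (ne_root_of_mem_dsc_ne h1 h2)
    have := dep_le_height h5
    have h6 := T.two_mul_card_top_le s
    have := lt_of_tight (T := T) le_rfl (by omega) (by unfold Tight at hs; rw [top] at hs h6; omega) h1 h3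
    omega

end ParentTree

open Finset

/-! ### Flips, walks and Hamming distance in the cube -/

section Cube

variable {ι : Type*} [Fintype ι] [DecidableEq ι]

/-- The point obtained from `x` by changing the coordinate `i`. -/
def flip (x : ι → ZMod 2) (i : ι) : ι → ZMod 2 := Function.update x i (x i + 1)

@[simp] theorem flip_self (x : ι → ZMod 2) (i : ι) : flip x i i = x i + 1 := by simp [flip]

theorem flip_of_ne (x : ι → ZMod 2) {i j : ι} (h : j ≠ i) : flip x i j = x j := by
  simp [flip, h]

theorem flip_self_ne (x : ι → ZMod 2) (i : ι) : flip x i i ≠ x i := by simp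

@[simp] theorem flip_flip (x : ι → ZMod 2) (i : ι) : flip (flip x i) i = x := by
  ext j
  by_cases h : j = i
  · subst h
    have : (1 : ZMod 2) + 1 = 0 := by decide
    simp [add_assoc, this]
  · simp [flip_of_ne _ h]

theorem flip_injective (x : ι → ZMod 2) : Function.Injective (flip x) := by
  intro i j h
  by_contra hne
  have := congrFun h i
  rw [flip_of_ne _ hne] at this
  exact flip_self_ne x i this

theorem hammingDist_flip {x z : ι → ZMod 2} {i : ι} (h : x i = z i) :
    hammingDist (flip x i) z = hammingDist x z + 1 := by
  have : (univ.filter fun j => flip x i j ≠ z j) = insert i (univ.filter fun j => x j ≠ z j) := by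
    ext j
    by_cases hj : j = i
    · subst hj; simp [← h]
    · simp [flip_of_ne _ hj, hj]
  unfold hammingDist
  rw [this, card_insert_of_notMem (by simp [h])]

theorem hammingDist_flip_self (x : ι → ZMod 2) (i : ι) : hammingDist x (flip x i) = 1 := by
  rw [hammingDist_comm, hammingDist_flip rfl, hammingDist_self]

/-- The end point of the walk that starts at `x` and flips the coordinates of a list in turn. -/
def walk : (ι → ZMod 2) → List ι → ι → ZMod 2
  | x, [] => x
  | x, i :: l => walk (flip x i) l

theorem walk_of_notMem {l : List ι} {i : ι} (h : i ∉ l) (x : ι → ZMod 2) :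
    walk x l i = x i := by
  induction l generalizing x with
  | nil => rfl
  | cons j l ih =>
    simp only [List.mem_cons, not_or] at h
    rw [walk, ih h.2, flip_of_ne _ h.1]

theorem hammingDist_walk {l : List ι} (h : l.Nodup) (x : ι → ZMod 2) :
    hammingDist x (walk x l) = l.length := by
  have key : ∀ l : List ι, l.Nodup → ∀ x y : ι → ZMod 2, (∀ i ∈ l, x i = y i) →
      hammingDist y (walk x l) = hammingDist y x + l.length := by
    intro l
    induction l with
    | nil => intro _ x y _; simp [walk]
    | cons j l ih =>
      intro hl x y hxy
      rw [List.nodup_cons] at hl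
      rw [walk, ih hl.2 (flip x j) y, hammingDist_comm, hammingDist_flip (hxy j (by simp)),
        hammingDist_comm, List.length_cons]
      · ring
      · intro i hi
        rw [flip_of_ne _ (by rintro rfl; exact hl.1 hi)]
        exact hxy i (by simp [hi])
  rw [key l h x x fun _ _ => rfl, hammingDist_self, zero_add]

/-- A set of edges of the cube on `ι`, given by their end points and directions, that is properly
colored, together with a starting vertex. The starting vertex and all vertices on edges have degree
at least `k`. -/
structure CubeColoring (ι K : Type*) [Fintype ι] [DecidableEq ι] (k : ℕ) where
  start : ι → ZMod 2
  edge : (ι → ZMod 2) → ι → Prop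
  color : (ι → ZMod 2) → ι → K
  edge_flip : ∀ x i, edge x i → edge (flip x i) i
  color_flip : ∀ x i, edge x i → color (flip x i) i = color x i
  proper : ∀ x i j, edge x i → edge x j → color x i = color x j → i = j
  le_degree_start : k ≤ {i | edge start i}.ncard
  le_degree : ∀ x i, edge x i → k ≤ {j | edge x j}.ncard

end Cube

/-! ### Positions of tree vertices in the cube -/

namespace ParentTree

variable {V : Type*} [Fintype V] [DecidableEq V] {T : ParentTree V}
variable {ι K : Type*} [Fintype ι] [DecidableEq ι] {k : ℕ} {S : CubeColoring ι K k}

/-- Auxiliary recursion for `pos`. -/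
def posAux (T : ParentTree V) (S : CubeColoring ι K k) (g : V → ι) : ℕ → V → ι → ZMod 2
  | 0, _ => S.start
  | m + 1, t => flip (posAux T S g m (T.par t)) (g t)

/-- The position of `t` in the cube when the edge from `par t` to `t` has direction `g t`. -/
def pos (T : ParentTree V) (S : CubeColoring ι K k) (g : V → ι) (t : V) : ι → ZMod 2 :=
  T.posAux S g (T.dep t) t

variable {g g' : V → ι} {P : Finset V} {r s t u w : V}

theorem pos_root : T.pos S g T.root = S.start := by simp [pos, T.dep_root, posAux]

theorem pos_of_ne_root (h : t ≠ T.root) : T.pos S g t = flip (T.pos S g (T.par t)) (g t) := by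
  rw [pos, T.dep_par t h, posAux, pos]

theorem pos_congr (hP : ∀ t ∈ P, T.par t ∈ P) (hg : ∀ t ∈ P, g' t = g t) (ht : t ∈ P) :
    T.pos S g' t = T.pos S g t := by
  have : ∀ t ∈ T.dsc T.root, t ∈ P → T.pos S g' t = T.pos S g t := by
    refine dsc_induction (fun _ => by rw [pos_root, pos_root]) ?_
    intro t _ h _ ih ht
    rw [pos_of_ne_root h, pos_of_ne_root h, ih (hP t ht), hg t ht]
  exact this t (mem_dsc_root t) ht

theorem pos_ch (h : s ∈ T.ch r) : T.pos S g s = flip (T.pos S g r) (g s) := by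
  obtain ⟨h1, rfl⟩ := mem_ch.1 h
  exact pos_of_ne_root h1

theorem hammingDist_pos_le (h : t ∈ T.dsc s) :
    hammingDist (T.pos S g s) (T.pos S g t) + T.dep s ≤ T.dep t := by
  refine dsc_induction (p := fun t => hammingDist (T.pos S g s) (T.pos S g t) + T.dep s ≤ T.dep t)
    (by simp) ?_ t h
  intro t _ _ hr ih
  have h1 := hammingDist_triangle (T.pos S g s) (T.pos S g (T.par t)) (T.pos S g t)
  rw [pos_of_ne_root (t := t) hr, hammingDist_flip_self] at h1
  rw [pos_of_ne_root (t := t) hr]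
  have := T.dep_par t hr
  omega

theorem pos_apply_of_forall_ne {i : ι} (h : t ∈ T.dsc s)
    (hi : ∀ w ∈ T.dsc s, w ≠ s → g w ≠ i) : T.pos S g t i = T.pos S g s i := by
  refine dsc_induction (p := fun t => T.pos S g t i = T.pos S g s i) rfl ?_ t h
  intro t ht hne hr ih
  rw [pos_of_ne_root hr, flip_of_ne _ (hi t ht hne).symm, ih]

theorem pos_apply_ne (hs : s ∈ T.ch r) (h : t ∈ T.dsc s)
    (hi : ∀ w ∈ T.dsc s, w ≠ s → g w ≠ g s) : T.pos S g t (g s) ≠ T.pos S g r (g s) := by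
  rw [pos_apply_of_forall_ne h hi, pos_ch hs]
  exact flip_self_ne _ _

theorem pos_apply_of_forall_ne_of_closed {i : ι} {U : Finset V} (hs : s ∈ T.ch r)
    (hU : U ⊆ T.dsc s) (hp : ∀ w ∈ U, w ≠ s → T.par w ∈ U) (hi : ∀ w ∈ U, g w ≠ i)
    (ht : t ∈ U) : T.pos S g t i = T.pos S g r i := by
  refine dsc_induction (p := fun t => t ∈ U → T.pos S g t i = T.pos S g r i) ?_ ?_ t (hU ht) ht
  · intro h
    rw [pos_ch hs, flip_of_ne _ (hi s h).symm]
  · intro t _ hne hr ih h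
    rw [pos_of_ne_root hr, flip_of_ne _ (hi t h).symm, ih (hp t h hne)]

/-- Each step inside U changes a fresh coordinate in which z still agrees with the current position,
so each step moves away from z by exactly one. -/
theorem hammingDist_pos_eq {U : Finset V} {z : ι → ZMod 2} (hs : s ∈ T.ch r)
    (hU : U ⊆ T.dsc s) (hp : ∀ w ∈ U, w ≠ s → T.par w ∈ U) (hinj : Set.InjOn g U)
    (hz : ∀ w ∈ U, z (g w) = T.pos S g r (g w)) (hu : u ∈ U) :
    hammingDist (T.pos S g u) z + T.dep r = T.dep u + hammingDist (T.pos S g r) z := by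
  refine dsc_induction (p := fun u => u ∈ U →
    hammingDist (T.pos S g u) z + T.dep r = T.dep u + hammingDist (T.pos S g r) z) ?_ ?_ u (hU hu) hu
  · intro h
    rw [pos_ch hs, hammingDist_flip (hz s h).symm, dep_ch hs]
    ring
  · intro t htd hne hr ih h
    have hd := T.dep_par t hr
    have h1 : T.pos S g (T.par t) (g t) = T.pos S g r (g t) := by
      -- Restricting to smaller depth excludes t itself, so by injectivity the direction `g t` has
      -- not been used on the way to its parent.
      refine pos_apply_of_forall_ne_of_closed (U := U.filter fun w => T.dep w < T.dep t) hs
        ((filter_subset _ _).trans hU) ?_ ?_ ?_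
      · intro w hw hws
        rw [mem_filter] at hw ⊢
        have := T.dep_par w (ne_root_of_mem_dsc_ne (hU hw.1) hws)
        exact ⟨hp w hw.1 hws, by omega⟩
      · intro w hw he
        rw [mem_filter] at hw
        rw [hinj hw.1 h he] at hw
        omega
      · rw [mem_filter]
        exact ⟨hp t h hne, by omega⟩
    have := ih (hp t h hne)
    rw [pos_of_ne_root hr, hammingDist_flip (by rw [h1, hz t h])]
    omega

/-! ### Rainbow partial embeddings and greedy placement -/

/-- The vertices of `P` form a rooted subtree of `T` that is mapped by `g` to a rainbow subgraph. -/
structure Good (T : ParentTree V) (S : CubeColoring ι K k) (g : V → ι) (P : Finset V) : Prop where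
  root_mem : T.root ∈ P
  par_mem : ∀ t ∈ P, T.par t ∈ P
  edge : ∀ t ∈ P, t ≠ T.root → S.edge (T.pos S g (T.par t)) (g t)
  rainbow : ∀ t ∈ P, t ≠ T.root → ∀ t' ∈ P, t' ≠ T.root →
    S.color (T.pos S g (T.par t)) (g t) = S.color (T.pos S g (T.par t')) (g t') → t = t'

theorem Good.edge_pos (h : T.Good S g P) (ht : t ∈ P) (hr : t ≠ T.root) :
    S.edge (T.pos S g t) (g t) := by
  rw [pos_of_ne_root hr]
  exact S.edge_flip _ _ (h.edge t ht hr)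

theorem Good.color_pos (h : T.Good S g P) (ht : t ∈ P) (hr : t ≠ T.root) :
    S.color (T.pos S g t) (g t) = S.color (T.pos S g (T.par t)) (g t) := by
  rw [pos_of_ne_root hr]
  exact S.color_flip _ _ (h.edge t ht hr)

theorem Good.le_degree (h : T.Good S g P) (ht : t ∈ P) :
    k ≤ {i | S.edge (T.pos S g t) i}.ncard := by
  by_cases hr : t = T.root
  · subst hr
    rw [pos_root]
    exact S.le_degree_start
  · exact S.le_degree _ _ (h.edge_pos ht hr)

theorem Good.congr (h : T.Good S g P) (hg : ∀ t ∈ P, g' t = g t) : T.Good S g' P where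
  root_mem := h.root_mem
  par_mem := h.par_mem
  edge t ht hr := by
    rw [pos_congr h.par_mem hg (h.par_mem t ht), hg t ht]
    exact h.edge t ht hr
  rainbow t ht hr t' ht' hr' he := by
    rw [pos_congr h.par_mem hg (h.par_mem t ht), hg t ht,
      pos_congr h.par_mem hg (h.par_mem t' ht'), hg t' ht'] at he
    exact h.rainbow t ht hr t' ht' hr' he

theorem Good.dsc_notMem (h : T.Good S g P) (hs : s ∉ P) (ht : t ∈ T.dsc s) : t ∉ P := by
  refine dsc_induction (p := fun t => t ∉ P) hs ?_ t ht
  intro t _ _ _ h1 h2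
  exact h1 (h.par_mem t h2)

theorem Good.child_ne (h : T.Good S g P) (hs : s ∈ T.ch r) (ht : t ∈ T.ch r) (hs' : s ∈ P)
    (ht' : t ∈ P) (hne : s ≠ t) : g s ≠ g t := by
  intro he
  rw [mem_ch] at hs ht
  refine hne (h.rainbow s hs' hs.1 t ht' ht.1 ?_)
  rw [hs.2, ht.2, he]

theorem Good.child_ne_par (h : T.Good S g P) (hs : s ∈ T.ch r) (hs' : s ∈ P) (hr : r ≠ T.root) :
    g s ≠ g r := by
  intro he
  rw [mem_ch] at hs
  have hrP : r ∈ P := hs.2 ▸ h.par_mem s hs'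
  have := h.rainbow s hs' hs.1 r hrP hr (by rw [hs.2, he, h.color_pos hrP hr])
  have h2 := T.dep_par s hs.1
  rw [hs.2, this] at h2
  omega

/-- By properness each of the #P - 1 used colors blocks at most one direction at the parent, so at
least k - (#P - 1) - #A ≥ 1 directions remain. An edge already placed at the parent blocks its own
direction. -/
theorem Good.place (h : T.Good S g P) (ht : t ∉ P) (hu : T.par t ∈ P) {A : Finset ι}
    (hA : #P + #A ≤ k) :
    ∃ i ∉ A, (∀ w ∈ P, w ≠ T.root → w = T.par t ∨ T.par w = T.par t → g w ≠ i) ∧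
      T.Good S (Function.update g t i) (insert t P) := by
  classical
  have : Nonempty V := ⟨T.root⟩
  set x := T.pos S g (T.par t) with hx
  have hrt : t ≠ T.root := fun e => ht (e ▸ h.root_mem)
  let D : Finset ι := univ.filter fun i => S.edge x i
  let B : Finset ι := D.filter fun i =>
    ∃ w ∈ P, w ≠ T.root ∧ S.color (T.pos S g (T.par w)) (g w) = S.color x i
  have hD : k ≤ #D := by
    have := h.le_degree hu
    rwa [← hx, Set.ncard_eq_toFinset_card', Set.toFinset_ofPred] at this
  have hB : #B ≤ #(P.erase T.root) := by
    have hex : ∀ i ∈ B, ∃ w ∈ P.erase T.root,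
        S.color (T.pos S g (T.par w)) (g w) = S.color x i := by
      intro i hi
      obtain ⟨w, hw, hr, he⟩ := (mem_filter.1 hi).2
      exact ⟨w, mem_erase.2 ⟨hr, hw⟩, he⟩
    choose! f hf hfc using hex
    refine card_le_card_of_injOn f hf ?_
    intro i hi j hj hij
    have hi' : S.edge x i := by simpa [D] using (mem_filter.1 (mem_coe.1 hi)).1
    have hj' : S.edge x j := by simpa [D] using (mem_filter.1 (mem_coe.1 hj)).1
    refine S.proper x i j hi' hj' ?_
    rw [← hfc i hi, ← hfc j hj, hij]
  rw [card_erase_of_mem h.root_mem] at hB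
  have hP : 1 ≤ #P := card_pos.2 ⟨_, h.root_mem⟩
  obtain ⟨i, hiD, hi⟩ : ∃ i ∈ D, i ∉ B ∪ A := by
    by_contra hcon
    push Not at hcon
    have h1 := card_le_card (show D ⊆ B ∪ A from hcon)
    have h2 := card_union_le B A
    omega
  have hedge : S.edge x i := by simpa [D] using hiD
  rw [mem_union, not_or] at hi
  have hcol : ∀ w ∈ P, w ≠ T.root → S.color (T.pos S g (T.par w)) (g w) ≠ S.color x i := by
    intro w hw hr he
    exact hi.1 (mem_filter.2 ⟨hiD, w, hw, hr, he⟩)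
  have hagree : ∀ w ∈ P, Function.update g t i w = g w := by
    intro w hw
    rw [Function.update_of_ne (by rintro rfl; exact ht hw)]
  have hgood := h.congr hagree
  have hpos : ∀ w ∈ P, T.pos S (Function.update g t i) w = T.pos S g w := fun w hw =>
    pos_congr h.par_mem hagree hw
  refine ⟨i, hi.2, ?_, ?_⟩
  · rintro w hw hr hwt rfl
    rcases hwt with hwt | hwt
    · exact hcol w hw hr (by rw [← h.color_pos hw hr, hx, hwt])
    · exact hcol w hw hr (by rw [hwt])
  · refine ⟨mem_insert_of_mem h.root_mem, ?_, ?_, ?_⟩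
    · intro w hw
      rcases mem_insert.1 hw with rfl | hw
      · exact mem_insert_of_mem hu
      · exact mem_insert_of_mem (h.par_mem w hw)
    · intro w hw hr
      rcases mem_insert.1 hw with rfl | hw
      · rw [hpos _ hu, Function.update_self]
        exact hedge
      · exact hgood.edge w hw hr
    · intro w hw hr w' hw' hr' he
      rcases mem_insert.1 hw with rfl | hwP <;> rcases mem_insert.1 hw' with rfl | hwP'
      · rfl
      · rw [hpos _ hu, Function.update_self, hpos _ (h.par_mem w' hwP'), hagree w' hwP'] at he
        exact absurd he.symm (hcol w' hwP' hr')
      · rw [hpos _ hu, Function.update_self, hpos _ (h.par_mem w hwP), hagree w hwP] at he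
        exact absurd he (hcol w hwP hr)
      · exact hgood.rainbow w hwP hr w' hwP' hr' he

/-! ### Placing top halves, branch roots and leaves -/

theorem card_branches_sdiff {L : Finset V} (hL : L ⊆ T.ch r) (P : Finset V) :
    #(T.branches L \ P) = ∑ l ∈ L, #(T.dsc l \ P) := by
  have : T.branches L \ P = L.biUnion fun l => T.dsc l \ P := by
    ext t
    simp only [mem_sdiff, mem_branches, mem_biUnion]
    tauto
  rw [this, card_biUnion]
  intro x hx y hy hne
  exact (disjoint_dsc (hL hx) (hL hy) hne).mono sdiff_subset sdiff_subset

theorem card_toFinset_take_le (Δ : List ι) (m : ℕ) : #(Δ.take m).toFinset ≤ m :=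
  (List.toFinset_card_le _).trans (List.length_take_le _ _)

/-- All of A is avoided, but only A' is charged: the rest of A consists of directions of edges
already placed at the parent. -/
theorem Good.extend (h : T.Good S g P) (ht : t ∉ P) (hu : T.par t ∈ P) (A A' : Finset ι)
    (hAA : ∀ a ∈ A, a ∈ A' ∨
      ∃ w ∈ P, w ≠ T.root ∧ (w = T.par t ∨ T.par w = T.par t) ∧ g w = a)
    (hA : #P + #A' ≤ k) :
    ∃ g' : V → ι, (∀ w ∈ P, g' w = g w) ∧ T.Good S g' (insert t P) ∧ g' t ∉ A := by
  obtain ⟨i, hi, hadj, hgood⟩ := h.place ht hu hA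
  refine ⟨_, ?_, hgood, ?_⟩
  · intro w hw
    rw [Function.update_of_ne (by rintro rfl; exact ht hw)]
  · rw [Function.update_self]
    intro hiA
    rcases hAA i hiA with h1 | ⟨w, hw, hr, hwt, he⟩
    · exact hi h1
    · exact hadj w hw hr hwt he

/-- The top half is filled in decreasing order of height minus depth. Then the placed part always
lies in a small `upper` set, and the unplaced part of the branch pays for distinct directions and
for the prefix of Δ. Without a walk to avoid, one unit of budget is saved. -/
theorem Good.fill_top (h : T.Good S g P) (hs : s ≠ T.root) (hsP : s ∈ P)
    (hup : ∀ w ∈ P, w ∈ T.dsc s → ∀ t ∈ T.dsc s, t ∉ P →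
      T.height t + T.dep w ≤ T.height w + T.dep t)
    (hinj : Set.InjOn g ↑(P ∩ T.dsc s)) (A : Finset ι) (Δ : List ι)
    (hb : #P + #A + #(T.dsc s \ P) ≤ k + 1 ∨ Δ = [] ∧ #P + #A + #(T.dsc s \ P) ≤ k + 2) :
    ∃ g' : V → ι, (∀ w ∈ P, g' w = g w) ∧ T.Good S g' (P ∪ T.top s) ∧
      Set.InjOn g' ↑((P ∪ T.top s) ∩ T.dsc s) ∧
      ∀ t ∈ T.top s, t ∉ P → g' t ∉ A ∧ g' t ∉ Δ.take (T.height t + 1 + T.dep s - T.dep t) := by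
  induction hN : #(T.top s \ P) generalizing g P with
  | zero =>
    have hsub : T.top s ⊆ P := by rwa [card_eq_zero, sdiff_eq_empty_iff_subset] at hN
    rw [union_eq_left.2 hsub]
    exact ⟨g, fun _ _ => rfl, h, hinj, fun t ht htP => absurd (hsub ht) htP⟩
  | succ N ih =>
    obtain ⟨t, ht, hmax⟩ := exists_max_image (T.top s \ P)
      (fun t => T.height t + T.dep s - T.dep t) (card_pos.1 (by omega))
    rw [mem_sdiff] at ht
    obtain ⟨htt, htP⟩ := ht
    have htd : t ∈ T.dsc s := upper_subset htt
    have hts : t ≠ s := by rintro rfl; exact htP hsP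
    have htr : t ≠ T.root := ne_root_of_mem_dsc_ne htd hts
    have hdt := T.dep_par t htr
    have htle := (mem_top.1 htt).2
    -- Height minus depth increases strictly towards the parent, so a maximal unplaced vertex has
    -- its parent placed.
    have hpar : T.par t ∈ P := by
      by_contra hp
      have h1 := hmax _ (mem_sdiff.2 ⟨par_mem_top htt hts, hp⟩)
      have h2 := height_par htd hts
      have h3 := (mem_top.1 (par_mem_top htt hts)).2
      omega
    have hpd := par_mem_dsc htd hts
    set W := P ∩ T.dsc s with hW
    set κ := T.height t + T.dep s - T.dep t with hκ
    have hpW : T.par t ∈ W := mem_inter.2 ⟨hpar, hpd⟩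
    have hpr : T.par t ≠ T.root := by
      intro he
      have h1 := dep_le hpd
      rw [he, T.dep_root] at h1
      have h2 := T.dep_par s hs
      omega
    -- By the order of placement, t and everything placed in this branch lie in `upper (1 + κ) s`,
    -- where κ is the slack of t.
    have hcard : 2 * #W + κ + 1 ≤ #(T.dsc s) := by
      have h1 : insert t W ⊆ T.upper (1 + κ) s := by
        intro w hw
        rcases mem_insert.1 hw with rfl | hw
        · exact mem_upper.2 ⟨htd, by omega⟩
        · obtain ⟨hwP, hwd⟩ := mem_inter.1 hw
          have := hup w hwP hwd t htd htP
          exact mem_upper.2 ⟨hwd, by omega⟩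
      have h2 := card_le_card h1
      have htW : t ∉ W := fun hw => htP (mem_inter.1 hw).1
      rw [card_insert_of_notMem htW] at h2
      have h3 := two_mul_card_upper_le (T := T) (s := s) (m := 1 + κ) (by omega)
        (le_of_mem_upper (h1 (mem_insert_self t W)))
      omega
    have hsd : #(T.dsc s \ P) + #W = #(T.dsc s) := by
      rw [hW, inter_comm]
      exact card_sdiff_add_card_inter _ _
    have hW1 : 1 ≤ #W := card_pos.2 ⟨_, hpW⟩
    obtain ⟨g₁, hg₁, hgood₁, hA₁⟩ := h.extend htP hpar
      (A ∪ W.image g ∪ (Δ.take (κ + 1)).toFinset)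
      (A ∪ (W.erase (T.par t)).image g ∪ (Δ.take (κ + 1)).toFinset) (by
        intro a ha
        rw [mem_union, mem_union] at ha ⊢
        rcases ha with (ha | ha) | ha
        · exact Or.inl (Or.inl (Or.inl ha))
        · obtain ⟨w, hw, rfl⟩ := mem_image.1 ha
          by_cases hwt : w = T.par t
          · exact Or.inr ⟨w, (mem_inter.1 hw).1, hwt ▸ hpr, Or.inl hwt, rfl⟩
          · exact Or.inl (Or.inl (Or.inr (mem_image_of_mem g (mem_erase.2 ⟨hwt, hw⟩))))
        · exact Or.inl (Or.inr ha)) (by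
        have h1 := card_union_le (A ∪ (W.erase (T.par t)).image g) (Δ.take (κ + 1)).toFinset
        have h2 := card_union_le A ((W.erase (T.par t)).image g)
        have h3 := card_image_le (s := W.erase (T.par t)) (f := g)
        rw [card_erase_of_mem hpW] at h3
        rcases hb with hb | ⟨rfl, hb⟩
        · have h4 := card_toFinset_take_le Δ (κ + 1)
          omega
        · simp only [List.take_nil, List.toFinset_nil, card_empty] at h1 ⊢
          omega)
    simp only [mem_union, not_or, List.mem_toFinset, mem_image, not_exists, not_and] at hA₁
    obtain ⟨⟨hA₁, hW₁⟩, hΔ₁⟩ := hA₁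
    have hcP : #(insert t P) = #P + 1 := card_insert_of_notMem htP
    have hcd : #(T.dsc s \ insert t P) + 1 = #(T.dsc s \ P) := by
      rw [sdiff_insert, card_erase_add_one (mem_sdiff.2 ⟨htd, htP⟩)]
    have hct : #(T.top s \ insert t P) + 1 = #(T.top s \ P) := by
      rw [sdiff_insert, card_erase_add_one (mem_sdiff.2 ⟨htt, htP⟩)]
    obtain ⟨g₂, hg₂, hgood₂, hinj₂, hA₂⟩ := ih hgood₁ (mem_insert_of_mem hsP) (by
        intro w hw hwd x hx hxP
        rw [mem_insert, not_or] at hxP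
        rcases mem_insert.1 hw with rfl | hwP
        · by_cases hxt : x ∈ T.top s
          · have h1 := hmax x (mem_sdiff.2 ⟨hxt, hxP.2⟩)
            have h2 := (mem_top.1 hxt).2
            omega
          · have : ¬ T.dep x ≤ T.height x + T.dep s := fun h => hxt (mem_top.2 ⟨hx, h⟩)
            omega
        · exact hup w hwP hwd x hx hxP.2) (by
        intro x hx y hy hxy
        have key : ∀ x ∈ insert t P ∩ T.dsc s, x = t ∨ x ∈ W := by
          intro x hx
          rw [mem_inter, mem_insert] at hx
          rcases hx with ⟨hx | hx, hxd⟩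
          · exact Or.inl hx
          · exact Or.inr (mem_inter.2 ⟨hx, hxd⟩)
        have hgW : ∀ x ∈ W, g₁ x = g x := fun x hx => hg₁ x (mem_inter.1 hx).1
        rcases key x hx with rfl | hxW <;> rcases key y hy with rfl | hyW
        · rfl
        · rw [hgW y hyW] at hxy
          exact absurd hxy.symm (hW₁ y hyW)
        · rw [hgW x hxW] at hxy
          exact absurd hxy (hW₁ x hxW)
        · rw [hgW x hxW, hgW y hyW] at hxy
          exact hinj hxW hyW hxy) (by
        rcases hb with hb | ⟨hΔ, hb⟩
        · exact Or.inl (by omega)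
        · exact Or.inr ⟨hΔ, by omega⟩) (by omega)
    have hun : insert t P ∪ T.top s = P ∪ T.top s := by
      rw [insert_union, insert_eq_of_mem (mem_union_right _ htt)]
    rw [hun] at hgood₂ hinj₂
    refine ⟨g₂, fun w hw => ?_, hgood₂, hinj₂, fun x hx hxP => ?_⟩
    · rw [hg₂ w (mem_insert_of_mem hw), hg₁ w hw]
    · by_cases hxt : x = t
      · subst hxt
        rw [hg₂ x (mem_insert_self _ _)]
        refine ⟨hA₁, ?_⟩
        rwa [show T.height x + 1 + T.dep s - T.dep x = κ + 1 by omega]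
      · exact hA₂ x hx (by simp [hxt, hxP])

theorem card_inter_erase_le {L : Finset V} (hL : L ⊆ T.ch r) {l : V} (hl : l ∈ L)
    (hcard : 1 < #(T.dsc l))
    (hdeep : ∀ w ∈ P, w ∈ T.branches L → T.dep w ≤ T.height w + T.dep r) :
    #((P ∩ T.dsc l).erase l) ≤ #(T.dsc l \ P) := by
  have hd := dep_ch (hL hl)
  have hsub : insert l (P ∩ T.dsc l) ⊆ T.upper 2 l := by
    intro w hw
    rcases mem_insert.1 hw with rfl | hw
    · have := one_le_height hcard
      exact mem_upper.2 ⟨self_mem_dsc _, by omega⟩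
    · obtain ⟨hw, hwd⟩ := mem_inter.1 hw
      have := hdeep w hw (mem_branches.2 ⟨l, hl, hwd⟩)
      exact mem_upper.2 ⟨hwd, by omega⟩
  have h1 := card_le_card hsub
  have h2 := T.two_mul_card_upper_two_le l
  have h3 : #(T.dsc l \ P) + #(P ∩ T.dsc l) = #(T.dsc l) := by
    rw [inter_comm]
    exact card_sdiff_add_card_inter _ _
  have h4 : #((P ∩ T.dsc l).erase l) + 1 ≤ #(insert l (P ∩ T.dsc l)) := by
    rw [← erase_insert_eq_erase, card_erase_add_one (mem_insert_self _ _)]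
  have h5 : #(P ∩ T.dsc l) ≤ #(insert l (P ∩ T.dsc l)) := card_le_card (subset_insert _ _)
  omega

/-- Several requirements are free at r: the directions of roots already placed, that of s, and the
head of Δ. What was placed deeper in another branch is paid for by its unplaced vertices, and the
prefix of Δ by the still empty branch of l, which has more than `height l` vertices. -/
theorem Good.place_branch_roots (h : T.Good S g P) (hrP : r ∈ P) {L : Finset V} (hL : L ⊆ T.ch r)
    (hcard : ∀ l ∈ L, 1 < #(T.dsc l))
    (hdeep : ∀ w ∈ P, w ∈ T.branches L → T.dep w ≤ T.height w + T.dep r)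
    (hinj : Set.InjOn g ↑(P ∩ T.branches L)) {Δ : List ι}
    (hhead : ∀ i, Δ.head? = some i → r ≠ T.root ∧ i = g r) {A : Finset ι}
    (hs : s ∈ T.ch r) (hsP : s ∈ P) (hsA : g s ∈ A)
    (hb : #P + #A + #(T.branches L \ P) ≤ k + 2) :
    ∃ g' : V → ι, (∀ w ∈ P, g' w = g w) ∧ T.Good S g' (P ∪ L) ∧
      Set.InjOn g' ↑((P ∪ L) ∩ T.branches L) ∧
      ∀ l ∈ L, l ∉ P → g' l ∉ A ∧ g' l ∉ Δ.take (T.height l + 1) := by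
  induction hN : #(L \ P) generalizing g P with
  | zero =>
    have hsub : L ⊆ P := by rwa [card_eq_zero, sdiff_eq_empty_iff_subset] at hN
    rw [union_eq_left.2 hsub]
    exact ⟨g, fun _ _ => rfl, h, hinj, fun t ht htP => absurd (hsub ht) htP⟩
  | succ N ih =>
    obtain ⟨l, hl⟩ := card_pos.1 (show 0 < #(L \ P) by omega)
    rw [mem_sdiff] at hl
    obtain ⟨hlL, hlP⟩ := hl
    have hlch := mem_ch.1 (hL hlL)
    have hlb : l ∈ T.branches L := mem_branches.2 ⟨l, hlL, self_mem_dsc l⟩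
    set W := P ∩ T.branches L with hW
    have hsch := mem_ch.1 hs
    have hWL : #(W \ L) + T.height l + 1 ≤ #(T.branches L \ P) := by
      have h1 : W \ L ⊆ (L.erase l).biUnion fun m => (P ∩ T.dsc m).erase m := by
        intro w hw
        rw [mem_sdiff, hW, mem_inter, mem_branches] at hw
        obtain ⟨⟨hwP, m, hm, hwm⟩, hwL⟩ := hw
        refine mem_biUnion.2 ⟨m, mem_erase.2 ⟨?_, hm⟩, mem_erase.2 ⟨?_, mem_inter.2 ⟨hwP, hwm⟩⟩⟩
        · rintro rfl
          exact h.dsc_notMem hlP hwm hwP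
        · rintro rfl
          exact hwL hm
      have h2 := (card_le_card h1).trans card_biUnion_le
      have h3 := Finset.sum_le_sum fun m (hm : m ∈ L.erase l) =>
        card_inter_erase_le hL (mem_of_mem_erase hm) (hcard m (mem_of_mem_erase hm)) hdeep
      rw [card_branches_sdiff hL, ← Finset.add_sum_erase _ _ hlL]
      have h4 : T.dsc l \ P = T.dsc l := by
        rw [Finset.sdiff_eq_self_iff_disjoint, disjoint_left]
        exact fun t ht => h.dsc_notMem hlP ht
      have h5 := T.height_lt_card l
      rw [h4]
      omega
    have hA1 : 1 ≤ #A := card_pos.2 ⟨_, hsA⟩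
    obtain ⟨g₁, hg₁, hgood₁, hA₁⟩ := h.extend hlP (hlch.2 ▸ hrP)
      (A ∪ W.image g ∪ (Δ.take (T.height l + 1)).toFinset)
      (A.erase (g s) ∪ (W \ L).image g ∪ (Δ.tail.take (T.height l)).toFinset) (by
        intro a ha
        rw [mem_union, mem_union] at ha
        rw [mem_union]
        rcases ha with (ha | ha) | ha
        · by_cases has : a = g s
          · exact Or.inr ⟨s, hsP, hsch.1, Or.inr (hsch.2.trans hlch.2.symm), has.symm⟩
          · exact Or.inl (Or.inl (mem_union.2 (Or.inl (mem_erase.2 ⟨has, ha⟩))))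
        · obtain ⟨w, hw, rfl⟩ := mem_image.1 ha
          by_cases hwL : w ∈ L
          · have := mem_ch.1 (hL hwL)
            exact Or.inr ⟨w, (mem_inter.1 hw).1, this.1, Or.inr (this.2.trans hlch.2.symm), rfl⟩
          · exact Or.inl (Or.inl (mem_union.2 (Or.inr
              (mem_image_of_mem g (mem_sdiff.2 ⟨hw, hwL⟩)))))
        · cases Δ with
          | nil => simp at ha
          | cons i Δ =>
            obtain ⟨hr, hi⟩ := hhead i rfl
            simp only [List.take_succ_cons, List.toFinset_cons, mem_insert] at ha
            rcases ha with rfl | ha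
            · exact Or.inr ⟨r, hrP, hr, Or.inl hlch.2.symm, hi.symm⟩
            · exact Or.inl (Or.inr ha)) (by
        have h1 := card_union_le (A.erase (g s) ∪ (W \ L).image g)
          (Δ.tail.take (T.height l)).toFinset
        have h2 := card_union_le (A.erase (g s)) ((W \ L).image g)
        have h3 := card_image_le (s := W \ L) (f := g)
        have h4 := card_toFinset_take_le Δ.tail (T.height l)
        rw [card_erase_of_mem hsA] at h2
        omega)
    simp only [mem_union, not_or, List.mem_toFinset, mem_image, not_exists, not_and] at hA₁
    obtain ⟨⟨hA₁, hW₁⟩, hΔ₁⟩ := hA₁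
    have hcP : #(insert l P) = #P + 1 := card_insert_of_notMem hlP
    have hcd : #(T.branches L \ insert l P) + 1 = #(T.branches L \ P) := by
      rw [sdiff_insert, card_erase_add_one (mem_sdiff.2 ⟨hlb, hlP⟩)]
    have hct : #(L \ insert l P) + 1 = #(L \ P) := by
      rw [sdiff_insert, card_erase_add_one (mem_sdiff.2 ⟨hlL, hlP⟩)]
    obtain ⟨g₂, hg₂, hgood₂, hinj₂, hA₂⟩ := ih hgood₁ (mem_insert_of_mem hrP) (by
        intro w hw hwb
        rcases mem_insert.1 hw with rfl | hw
        · have := dep_ch (hL hlL)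
          have := one_le_height (hcard w hlL)
          omega
        · exact hdeep w hw hwb) (by
        intro x hx y hy hxy
        have key : ∀ x ∈ insert l P ∩ T.branches L, x = l ∨ x ∈ W := by
          intro x hx
          rw [mem_inter, mem_insert] at hx
          rcases hx with ⟨hx | hx, hxd⟩
          · exact Or.inl hx
          · exact Or.inr (mem_inter.2 ⟨hx, hxd⟩)
        have hgW : ∀ x ∈ W, g₁ x = g x := fun x hx => hg₁ x (mem_inter.1 hx).1
        rcases key x hx with rfl | hxW <;> rcases key y hy with rfl | hyW
        · rfl
        · rw [hgW y hyW] at hxy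
          exact absurd hxy.symm (hW₁ y hyW)
        · rw [hgW x hxW] at hxy
          exact absurd hxy (hW₁ x hxW)
        · rw [hgW x hxW, hgW y hyW] at hxy
          exact hinj hxW hyW hxy) (by rwa [hg₁ r hrP]) (mem_insert_of_mem hsP)
      (by rwa [hg₁ s hsP]) (by omega) (by omega)
    have hun : insert l P ∪ L = P ∪ L := by
      rw [insert_union, insert_eq_of_mem (mem_union_right _ hlL)]
    rw [hun] at hgood₂ hinj₂
    refine ⟨g₂, fun w hw => ?_, hgood₂, hinj₂, fun x hx hxP => ?_⟩
    · rw [hg₂ w (mem_insert_of_mem hw), hg₁ w hw]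
    · by_cases hxt : x = l
      · subst hxt
        rw [hg₂ x (mem_insert_self _ _)]
        exact ⟨hA₁, hΔ₁⟩
      · exact hA₂ x hx (by simp [hxt, hxP])

/-- The budget k + 2 suffices because `g s`, a direction at r, belongs to A and costs nothing, and
because the leaf being placed is itself still counted as unplaced. -/
theorem Good.place_leaves (h : T.Good S g P) (hrP : r ∈ P) {L : Finset V} (hL : L ⊆ T.ch r)
    {A : Finset ι} (hs : s ∈ T.ch r) (hsP : s ∈ P) (hsA : g s ∈ A)
    (hb : #P + #A + #(L \ P) ≤ k + 2) :
    ∃ g' : V → ι, (∀ w ∈ P, g' w = g w) ∧ T.Good S g' (P ∪ L) ∧ ∀ l ∈ L, l ∉ P → g' l ∉ A := by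
  induction hN : #(L \ P) generalizing g P with
  | zero =>
    have hsub : L ⊆ P := by rwa [card_eq_zero, sdiff_eq_empty_iff_subset] at hN
    rw [union_eq_left.2 hsub]
    exact ⟨g, fun _ _ => rfl, h, fun t ht htP => absurd (hsub ht) htP⟩
  | succ N ih =>
    obtain ⟨l, hl⟩ := card_pos.1 (show 0 < #(L \ P) by omega)
    rw [mem_sdiff] at hl
    obtain ⟨hlL, hlP⟩ := hl
    have hlch := mem_ch.1 (hL hlL)
    have hsch := mem_ch.1 hs
    have hA1 : 1 ≤ #A := card_pos.2 ⟨_, hsA⟩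
    obtain ⟨g₁, hg₁, hgood₁, hA₁⟩ := h.extend hlP (hlch.2 ▸ hrP) A (A.erase (g s)) (by
        intro a ha
        by_cases has : a = g s
        · exact Or.inr ⟨s, hsP, hsch.1, Or.inr (hsch.2.trans hlch.2.symm), has.symm⟩
        · exact Or.inl (mem_erase.2 ⟨has, ha⟩)) (by
        rw [card_erase_of_mem hsA]
        omega)
    have hcP : #(insert l P) = #P + 1 := card_insert_of_notMem hlP
    have hct : #(L \ insert l P) + 1 = #(L \ P) := by
      rw [sdiff_insert, card_erase_add_one (mem_sdiff.2 ⟨hlL, hlP⟩)]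
    obtain ⟨g₂, hg₂, hgood₂, hA₂⟩ := ih hgood₁ (mem_insert_of_mem hrP) (mem_insert_of_mem hsP)
      (by rwa [hg₁ s hsP]) (by omega) (by omega)
    have hun : insert l P ∪ L = P ∪ L := by
      rw [insert_union, insert_eq_of_mem (mem_union_right _ hlL)]
    rw [hun] at hgood₂
    refine ⟨g₂, fun w hw => ?_, hgood₂, fun x hx hxP => ?_⟩
    · rw [hg₂ w (mem_insert_of_mem hw), hg₁ w hw]
    · by_cases hxt : x = l
      · subst hxt
        rwa [hg₂ x (mem_insert_self _ _)]
      · exact hA₂ x hx (by simp [hxt, hxP])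

/-! ### The induction statement -/

/-- The partial embedding `g` of `P` can be extended to the branches at `r` rooted at the elements
of `C`, avoiding the vertices of the walk from `r` with directions `Δ` and the directions in `Φ`:
what is placed in these branches is close to `r`, and there is room for all requirements. -/
structure Ready (T : ParentTree V) (S : CubeColoring ι K k) (r : V) (C : Finset V) (Δ : List ι)
    (Φ : Finset ι) (g : V → ι) (P : Finset V) : Prop where
  good : T.Good S g P
  mem : r ∈ P
  subset : C ⊆ T.ch r
  deep : ∀ w ∈ P, w ∈ T.branches C → T.dep w ≤ T.height w + T.dep r
  up : ∀ w ∈ P, w ∈ T.branches C → ∀ t ∈ T.branches C, t ∉ P →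
    T.height t + T.dep w ≤ T.height w + T.dep t
  inj : Set.InjOn g ↑(P ∩ T.branches C)
  nodup : Δ.Nodup
  -- The walk starts along the tree edge from r to its parent, so children of r avoid its first
  -- direction for free.
  head : ∀ i, Δ.head? = some i → r ≠ T.root ∧ i = g r
  -- For a child t of r the length is `height t + 1`. For t at depth d below r it is d - 1 less: by
  -- the time the recursion reaches the parent of t, that many directions have been prepended to the
  -- list.
  compat : ∀ t ∈ P, t ∈ T.branches C → g t ∉ Δ.take (T.height t + 2 + T.dep r - T.dep t)
  budget : #P + #Φ + #(T.branches C \ P) ≤ k + 1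

/-- The embedding `g'` extends the partial embedding `g` of `P` to the branches at `r` rooted at the
elements of `C`, avoiding the vertices of the walk from `r` with directions `Δ` and the directions
in `Φ`. -/
structure Completes (T : ParentTree V) (S : CubeColoring ι K k) (r : V) (C : Finset V) (Δ : List ι)
    (Φ : Finset ι) (g : V → ι) (P : Finset V) (g' : V → ι) : Prop where
  agree : ∀ w ∈ P, g' w = g w
  good : T.Good S g' (P ∪ T.branches C)
  avoid : ∀ t ∈ T.branches C, t ∉ P → g' t ∉ Φ
  inj : Set.InjOn (T.pos S g') ↑(T.branches C)
  walk_ne : ∀ b ∈ T.branches C, ∀ j, T.pos S g' b ≠ walk (T.pos S g' r) (Δ.take j)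

/-- Every partial embedding that is ready for fewer than `N` vertices can be completed. -/
def Completable (T : ParentTree V) (S : CubeColoring ι K k) (N : ℕ) : Prop :=
  ∀ (r : V) (C : Finset V) (Δ : List ι) (Φ : Finset ι) (g : V → ι) (P : Finset V),
    T.Ready S r C Δ Φ g P → #(T.branches C) < N → ∃ g', T.Completes S r C Δ Φ g P g'

theorem branches_mono {C C' : Finset V} (h : C ⊆ C') : T.branches C ⊆ T.branches C' :=
  biUnion_subset_biUnion_of_subset_left _ h

theorem dsc_subset_branches {C : Finset V} (h : s ∈ C) : T.dsc s ⊆ T.branches C :=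
  fun _ ht => mem_branches.2 ⟨s, h, ht⟩

theorem branches_eq_union {C : Finset V} (h : s ∈ C) :
    T.branches C = T.dsc s ∪ T.branches (C.erase s) := by
  rw [branches, ← insert_erase h, biUnion_insert, erase_insert (notMem_erase s C)]
  rfl

theorem disjoint_dsc_branches {C : Finset V} (hC : C ⊆ T.ch r) (hs : s ∈ T.ch r) (h : s ∉ C) :
    Disjoint (T.dsc s) (T.branches C) := by
  rw [branches, disjoint_biUnion_right]
  intro x hx
  exact disjoint_dsc hs (hC hx) (by rintro rfl; exact h hx)

theorem card_branches_sdiff_eq {C : Finset V} (hC : C ⊆ T.ch r) (h : s ∈ C) (P : Finset V) :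
    #(T.branches C \ P) = #(T.dsc s \ P) + #(T.branches (C.erase s) \ P) := by
  rw [card_branches_sdiff hC, card_branches_sdiff ((erase_subset s C).trans hC),
    Finset.add_sum_erase C (fun l => #(T.dsc l \ P)) h]

/-- Vertices placed early lie in `upper 2 s`, at most half of the branch. Thus forbidding the
directions already placed in a branch is paid for by its unplaced vertices. -/
theorem card_inter_le_card_sdiff (hs : s ∈ T.ch r)
    (hdeep : ∀ w ∈ P, w ∈ T.dsc s → T.dep w ≤ T.height w + T.dep r) :
    #(P ∩ T.dsc s) ≤ #(T.dsc s \ P) := by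
  have hd := dep_ch hs
  have hsub : P ∩ T.dsc s ⊆ T.upper 2 s := by
    intro w hw
    obtain ⟨hw, hwd⟩ := mem_inter.1 hw
    have := hdeep w hw hwd
    exact mem_upper.2 ⟨hwd, by omega⟩
  have h1 := card_le_card hsub
  have h2 := T.two_mul_card_upper_two_le s
  have h3 : #(T.dsc s \ P) + #(P ∩ T.dsc s) = #(T.dsc s) := by
    rw [inter_comm]
    exact card_sdiff_add_card_inter _ _
  omega

theorem card_inter_branches_le {C : Finset V} (hC : C ⊆ T.ch r)
    (hdeep : ∀ w ∈ P, w ∈ T.branches C → T.dep w ≤ T.height w + T.dep r) :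
    #(P ∩ T.branches C) ≤ #(T.branches C \ P) := by
  rw [card_branches_sdiff hC, branches, inter_biUnion]
  exact card_biUnion_le.trans (Finset.sum_le_sum fun s hs =>
    card_inter_le_card_sdiff (hC hs) fun w hw hwd => hdeep w hw (dsc_subset_branches hs hwd))

theorem injOn_dsc {α : Type*} {f : V → α} (h : Set.InjOn f ↑(T.branches (T.ch s)))
    (hne : ∀ t ∈ T.branches (T.ch s), f t ≠ f s) : Set.InjOn f ↑(T.dsc s) := by
  rw [dsc_eq_insert, coe_insert, Set.injOn_insert (notMem_branches_ch s)]
  refine ⟨h, ?_⟩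
  rintro ⟨t, ht, he⟩
  exact hne t ht he

theorem card_add_card_sdiff_eq {P' D : Finset V} (h : P ⊆ P') (h' : P' ⊆ P ∪ D) :
    #P' + #(D \ P') = #P + #(D \ P) := by
  rw [← card_union_of_disjoint disjoint_sdiff, ← card_union_of_disjoint disjoint_sdiff,
    union_sdiff_self_eq_union, union_sdiff_self_eq_union]
  congr 1
  exact subset_antisymm (union_subset h' subset_union_right) (union_subset_union_left h)

/-- Besides Φ, the directions already placed in the other branches at r are forbidden, which those
branches pay for. The root s is placed first, with the head of Δ free; then the rest of the top half
follows. -/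
theorem Ready.fill_top {C : Finset V} {Δ : List ι} {Φ : Finset ι}
    (h : T.Ready S r C Δ Φ g P) (hs : s ∈ C) :
    ∃ g' : V → ι, (∀ w ∈ P, g' w = g w) ∧ T.Good S g' (P ∪ T.top s) ∧
      Set.InjOn g' ↑(T.top s) ∧
      (∀ t ∈ T.top s, g' t ∉ Δ.take (T.height t + 1 + T.dep s - T.dep t)) ∧
      ∀ t ∈ T.top s, t ∉ P → g' t ∉ Φ ∧ ∀ w ∈ P, w ∈ T.branches (C.erase s) → g' t ≠ g w := by
  have hsr := h.subset hs
  have hds := dep_ch hsr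
  obtain ⟨hroot, hpar⟩ := mem_ch.1 hsr
  set O := T.branches (C.erase s) with hO
  have hbud := h.budget
  rw [card_branches_sdiff_eq h.subset hs, ← hO] at hbud
  have hPO : #(P ∩ O) ≤ #(O \ P) :=
    card_inter_branches_le ((erase_subset s C).trans h.subset) fun w hw hwb =>
      h.deep w hw (branches_mono (erase_subset s C) hwb)
  set A := Φ ∪ (P ∩ O).image g with hA
  have hAcard : #A ≤ #Φ + #(O \ P) :=
    (card_union_le _ _).trans (Nat.add_le_add_left (card_image_le.trans hPO) _)
  obtain ⟨g₁, hg₁, hgood₁, hs₁⟩ : ∃ g₁ : V → ι, (∀ w ∈ P, g₁ w = g w) ∧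
      T.Good S g₁ (insert s P) ∧ (s ∉ P → g₁ s ∉ A ∧ g₁ s ∉ Δ.take (T.height s + 1)) := by
    by_cases hsP : s ∈ P
    · refine ⟨g, fun _ _ => rfl, ?_, fun h => absurd hsP h⟩
      rw [insert_eq_of_mem hsP]
      exact h.good
    · obtain ⟨g₁, hg₁, hgood₁, hA₁⟩ := h.good.extend hsP (hpar ▸ h.mem)
        (A ∪ (Δ.take (T.height s + 1)).toFinset) (A ∪ (Δ.tail.take (T.height s)).toFinset) (by
          intro a ha
          rcases mem_union.1 ha with ha | ha
          · exact Or.inl (mem_union_left _ ha)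
          · cases hΔ : Δ with
            | nil => simp [hΔ] at ha
            | cons i Δ' =>
              obtain ⟨hr, hi⟩ := h.head i (by rw [hΔ]; rfl)
              simp only [hΔ, List.take_succ_cons, List.toFinset_cons, mem_insert] at ha
              rcases ha with rfl | ha
              · exact Or.inr ⟨r, h.mem, hr, Or.inl hpar.symm, hi.symm⟩
              · exact Or.inl (mem_union_right _ ha)) (by
          have h1 := card_union_le A (Δ.tail.take (T.height s)).toFinset
          have h2 := card_toFinset_take_le Δ.tail (T.height s)
          have h3 : T.dsc s \ P = T.dsc s := by
            rw [Finset.sdiff_eq_self_iff_disjoint, disjoint_left]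
            exact fun t ht => h.good.dsc_notMem hsP ht
          have h4 := T.height_lt_card s
          rw [h3] at hbud
          omega)
      rw [mem_union, not_or, List.mem_toFinset] at hA₁
      exact ⟨g₁, hg₁, hgood₁, fun _ => hA₁⟩
  have hcard : #(insert s P) + #(T.dsc s \ insert s P) = #P + #(T.dsc s \ P) := by
    by_cases hsP : s ∈ P
    · rw [insert_eq_of_mem hsP]
    · have := card_erase_add_one (mem_sdiff.2 ⟨T.self_mem_dsc s, hsP⟩)
      rw [card_insert_of_notMem hsP, sdiff_insert]
      omega
  have hold : ∀ w ∈ insert s P, w ∈ T.dsc s → w ∈ P ∨ (s ∉ P ∧ w = s) := by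
    intro w hw hwd
    by_cases hwP : w ∈ P
    · exact Or.inl hwP
    · rcases mem_insert.1 hw with rfl | hw
      · exact Or.inr ⟨hwP, rfl⟩
      · exact Or.inl hw
  obtain ⟨g₂, hg₂, hgood₂, hinj₂, hA₂⟩ := hgood₁.fill_top hroot (mem_insert_self s P) (by
      intro w hw hwd t ht htP
      rcases hold w hw hwd with hwP | ⟨-, rfl⟩
      · exact h.up w hwP (dsc_subset_branches hs hwd) t (dsc_subset_branches hs ht)
          fun h => htP (mem_insert_of_mem h)
      · have := dep_add_height_le ht
        have := dep_le ht
        omega) (by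
      intro x hx y hy hxy
      obtain ⟨hx, hxd⟩ := mem_inter.1 (mem_coe.1 hx)
      obtain ⟨hy, hyd⟩ := mem_inter.1 (mem_coe.1 hy)
      rcases hold x hx hxd with hxP | ⟨hsP, rfl⟩ <;> rcases hold y hy hyd with hyP | ⟨hsP', rfl⟩
      · rw [hg₁ x hxP, hg₁ y hyP] at hxy
        exact h.inj (mem_inter.2 ⟨hxP, dsc_subset_branches hs hxd⟩)
          (mem_inter.2 ⟨hyP, dsc_subset_branches hs hyd⟩) hxy
      · exact absurd hxP (h.good.dsc_notMem hsP' hxd)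
      · exact absurd hyP (h.good.dsc_notMem hsP hyd)
      · rfl) A Δ (Or.inl (by omega))
  have hun : insert s P ∪ T.top s = P ∪ T.top s := by
    rw [insert_union, insert_eq_of_mem (mem_union_right _ (T.self_mem_top s))]
  rw [hun] at hgood₂ hinj₂
  have hg : ∀ w ∈ P, g₂ w = g w := fun w hw => by
    rw [hg₂ w (mem_insert_of_mem hw), hg₁ w hw]
  have hnew : ∀ t ∈ T.top s, t ∉ P →
      g₂ t ∉ A ∧ g₂ t ∉ Δ.take (T.height t + 1 + T.dep s - T.dep t) := by
    intro t ht htP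
    by_cases hts : t = s
    · subst hts
      rw [hg₂ t (mem_insert_self _ _), Nat.add_sub_cancel]
      exact hs₁ htP
    · exact hA₂ t ht (by simp [hts, htP])
  refine ⟨g₂, hg, hgood₂, ?_, ?_, ?_⟩
  · refine hinj₂.mono fun t ht => ?_
    exact mem_inter.2 ⟨mem_union_right _ ht, upper_subset ht⟩
  · intro t ht
    by_cases htP : t ∈ P
    · have := h.compat t htP (dsc_subset_branches hs (upper_subset ht))
      rw [hg t htP]
      rwa [show T.height t + 1 + T.dep s - T.dep t = T.height t + 2 + T.dep r - T.dep t by omega]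
    · exact (hnew t ht htP).2
  · intro t ht htP
    have h1 := (hnew t ht htP).1
    rw [hA, mem_union, not_or] at h1
    refine ⟨h1.1, fun w hw hwO he => h1.2 ?_⟩
    rw [he]
    exact mem_image_of_mem g (mem_inter.2 ⟨hw, hwO⟩)

/-! ### Separating and finishing branches -/

theorem lt_hammingDist_of_agree {z : ι → ZMod 2} (hs : s ∈ T.ch r)
    (hinj : Set.InjOn g ↑(T.top s)) (hz : ∀ w ∈ T.top s, z (g w) = T.pos S g r (g w))
    (hne : z ≠ T.pos S g r) (hu : u ∈ T.top s) :
    T.dep u < hammingDist (T.pos S g u) z + T.dep r := by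
  rw [hammingDist_pos_eq hs upper_subset (fun w hw => par_mem_top hw) hinj hz hu]
  have := hammingDist_pos.2 hne.symm
  omega

/-- Let u' be the top vertex above b. As the two top halves use disjoint directions, the distances
of u and u' from r add up, and by tightness b is closer to u' than u' is to r. The triangle
inequality leaves the required surplus. -/
theorem lt_hammingDist_of_tight {b : V} {s' : V} (hs : s ∈ T.ch r) (hs' : s' ∈ T.ch r)
    (htight : T.Tight s') (hinj : Set.InjOn g ↑(T.top s)) (hinj' : Set.InjOn g ↑(T.top s'))
    (hdisj : ∀ w ∈ T.top s, ∀ w' ∈ T.top s', g w ≠ g w') (hb : b ∈ T.dsc s') (hu : u ∈ T.top s) :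
    T.dep u < hammingDist (T.pos S g u) (T.pos S g b) + T.dep r := by
  obtain ⟨u', hu', hbu, hd⟩ := exists_top_of_tight htight hb
  have h1 := hammingDist_pos_eq (S := S) (z := T.pos S g u') hs upper_subset
    (fun w hw => par_mem_top hw) hinj (fun w hw =>
      pos_apply_of_forall_ne_of_closed hs' upper_subset (fun w hw => par_mem_top hw)
        (fun w' hw' => (hdisj w hw w' hw').symm) hu') hu
  have h2 := hammingDist_pos_eq (S := S) (z := T.pos S g r) hs' upper_subset
    (fun w hw => par_mem_top hw) hinj' (fun _ _ => rfl) hu'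
  rw [hammingDist_self, hammingDist_comm] at h2
  have h3 := hammingDist_triangle (T.pos S g u) (T.pos S g b) (T.pos S g u')
  have h4 := hammingDist_pos_le (S := S) (g := g) hbu
  rw [hammingDist_comm] at h4
  have h5 := dep_ch hs'
  omega

/-- O holds the other branches, already placed too far from the top half for descendants in the
branch of s to reach. It remains to apply the induction hypothesis below s and to check the walk
from r. -/
theorem Completable.finish {N : ℕ} (ih : T.Completable S N) (h : T.Good S g P) (hs : s ∈ T.ch r)
    (hN : #(T.dsc s) ≤ N) (hP : ∀ t ∈ T.dsc s, t ∈ P → t ∈ T.top s) (htop : T.top s ⊆ P)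
    (hinj : Set.InjOn g ↑(T.top s)) {Δ : List ι} (hΔ : Δ.Nodup)
    (hcompat : ∀ t ∈ T.top s, g t ∉ Δ.take (T.height t + 1 + T.dep s - T.dep t)) {Φ : Finset ι}
    (hb : #P + #Φ + #(T.dsc s \ P) ≤ k + 1) {O : Finset V} (hOP : O ⊆ P)
    (hO : ∀ b ∈ O, ∀ u ∈ T.top s, T.dep u < hammingDist (T.pos S g u) (T.pos S g b) + T.dep r)
    (hOinj : Set.InjOn (T.pos S g) ↑O)
    (hOwalk : ∀ b ∈ O, ∀ j, T.pos S g b ≠ walk (T.pos S g r) (Δ.take j)) :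
    ∃ g' : V → ι, (∀ w ∈ P, g' w = g w) ∧ T.Good S g' (P ∪ T.dsc s) ∧
      (∀ t ∈ T.dsc s, t ∉ P → g' t ∉ Φ) ∧ Set.InjOn (T.pos S g') ↑(T.dsc s ∪ O) ∧
      ∀ b ∈ T.dsc s ∪ O, ∀ j, T.pos S g' b ≠ walk (T.pos S g' r) (Δ.take j) := by
  have hds := dep_ch hs
  obtain ⟨hroot, hpar⟩ := mem_ch.1 hs
  have hsP : s ∈ P := htop (T.self_mem_top s)
  have hrP : r ∈ P := hpar ▸ h.par_mem s hsP
  have hsΔ : g s ∉ Δ.take (T.height s + 1) := by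
    have := hcompat s (T.self_mem_top s)
    rwa [Nat.add_sub_cancel] at this
  have hdsc : P ∪ T.branches (T.ch s) = P ∪ T.dsc s := by
    rw [dsc_eq_insert s, union_insert, insert_eq_of_mem (mem_union_left _ hsP)]
  have hsd : T.branches (T.ch s) \ P = T.dsc s \ P := by
    rw [dsc_eq_insert s, insert_sdiff_of_mem _ hsP]
  have hsub : ∀ t ∈ T.branches (T.ch s), t ∈ T.dsc s ∧ t ≠ s := fun t ht => mem_branches_ch.1 ht
  -- Stepping back from s along `g s` reaches r, so avoiding the extended walk from s avoids r and
  -- the start of its walk.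
  obtain ⟨g', hg'⟩ := ih s (T.ch s) (g s :: Δ.take (T.height s)) Φ g P
    { good := h
      mem := hsP
      subset := subset_rfl
      deep := fun w hw hwb => (mem_top.1 (hP w (hsub w hwb).1 hw)).2
      up := by
        intro w hw hwb t ht htP
        have h1 := (mem_top.1 (hP w (hsub w hwb).1 hw)).2
        have h2 : ¬ T.dep t ≤ T.height t + T.dep s := fun h =>
          htP (htop (mem_top.2 ⟨(hsub t ht).1, h⟩))
        omega
      inj := hinj.mono fun t ht => by
        obtain ⟨h1, h2⟩ := mem_inter.1 (mem_coe.1 ht)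
        exact hP t (hsub t h2).1 h1
      nodup := by
        refine List.nodup_cons.2 ⟨fun hm => hsΔ ?_, hΔ.sublist (List.take_sublist _ _)⟩
        exact (List.take_prefix_take_left (by omega)).subset hm
      head := by
        intro i hi
        simp only [List.head?_cons, Option.some.injEq] at hi
        exact ⟨hroot, hi.symm⟩
      compat := by
        intro t ht htb
        obtain ⟨htd, hts⟩ := hsub t htb
        have htt := hP t htd ht
        have h1 := (mem_top.1 htt).2
        have h2 := hcompat t htt
        rw [show T.height t + 2 + T.dep s - T.dep t
          = (T.height t + 1 + T.dep s - T.dep t) + 1 by omega, List.take_succ_cons,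
          List.mem_cons, not_or, List.take_take]
        refine ⟨fun he => hts (hinj htt (T.self_mem_top s) he), fun hm => h2 ?_⟩
        exact (List.take_prefix_take_left (min_le_left _ _)).subset hm
      budget := by rw [hsd]; exact hb } (by
    have := card_insert_of_notMem (T.notMem_branches_ch s)
    rw [← dsc_eq_insert] at this
    omega)
  have hpos : ∀ w ∈ P, T.pos S g' w = T.pos S g w := fun w hw =>
    pos_congr h.par_mem hg'.agree hw
  have hwalks : ∀ b ∈ T.dsc s, ∀ j, j ≤ T.height s →
      T.pos S g' b ≠ walk (T.pos S g' r) (Δ.take j) := by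
    intro b hb j hj
    have hr : T.pos S g' r = flip (T.pos S g' s) (g s) := by
      rw [hpos r hrP, hpos s hsP, pos_ch hs, flip_flip]
    by_cases hbs : b = s
    · subst hbs
      intro he
      have h1 := congrFun he (g b)
      rw [walk_of_notMem, hr, flip_self] at h1
      · simp at h1
      · exact fun hm => hsΔ ((List.take_prefix_take_left (by omega)).subset hm)
    · have := hg'.walk_ne b (mem_branches_ch.2 ⟨hb, hbs⟩) (j + 1)
      rwa [List.take_succ_cons, List.take_take, min_eq_left hj, walk, ← hr] at this
  have hwalk : ∀ b ∈ T.dsc s, ∀ j, T.pos S g' b ≠ walk (T.pos S g' r) (Δ.take j) := by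
    intro b hb j
    -- Longer prefixes end at distance more than `height s` from s. For length exactly `height s +
    -- 1` this uses that `g s` is not among the directions of the prefix.
    by_cases hj : (Δ.take j).length ≤ T.height s
    · have := hwalks b hb _ hj
      rwa [show Δ.take (Δ.take j).length = Δ.take j by simp] at this
    · intro he
      have h1 := hammingDist_walk (hΔ.sublist (List.take_sublist j Δ)) (T.pos S g r)
      have h2 := hammingDist_pos_le (S := S) (g := g') hb
      rw [he, hpos s hsP, hpos r hrP] at h2
      have h3 := dep_le_height hb
      by_cases hj' : (Δ.take j).length = T.height s + 1
      · have h4 : Δ.take j = Δ.take (T.height s + 1) := by rw [← hj']; simp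
        rw [pos_ch hs, hammingDist_flip (by rw [walk_of_notMem (h4 ▸ hsΔ)])] at h2
        omega
      · have h4 := hammingDist_triangle (T.pos S g r) (T.pos S g s)
          (walk (T.pos S g r) (Δ.take j))
        rw [pos_ch hs, hammingDist_flip_self, ← pos_ch hs] at h4
        omega
  have hdO : ∀ b ∈ T.dsc s, ∀ c ∈ O, T.pos S g' b ≠ T.pos S g' c := by
    intro b hb c hc he
    obtain ⟨u, hu, hbu, hd⟩ := exists_top hb
    have h1 := hO c hc u hu
    rw [← hpos u (htop hu), ← hpos c (hOP hc), ← he] at h1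
    have h2 := hammingDist_pos_le (S := S) (g := g') hbu
    omega
  have hdinj : Set.InjOn (T.pos S g') ↑(T.dsc s) :=
    injOn_dsc hg'.inj fun t ht => hg'.walk_ne t ht 0
  refine ⟨g', hg'.agree, hdsc ▸ hg'.good, ?_, ?_, ?_⟩
  · intro t ht htP
    refine hg'.avoid t (mem_branches_ch.2 ⟨ht, ?_⟩) htP
    rintro rfl
    exact htP hsP
  · intro x hx y hy hxy
    rcases mem_union.1 (mem_coe.1 hx) with hx | hx <;>
      rcases mem_union.1 (mem_coe.1 hy) with hy | hy
    · exact hdinj hx hy hxy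
    · exact absurd hxy (hdO x hx y hy)
    · exact absurd hxy.symm (hdO y hy x hx)
    · rw [hpos x (hOP hx), hpos y (hOP hy)] at hxy
      exact hOinj hx hy hxy
  · intro b hb j
    rcases mem_union.1 hb with hb | hb
    · exact hwalk b hb j
    · rw [hpos b (hOP hb), hpos r hrP]
      exact hOwalk b hb j

/-- The branches are finished one at a time. Each root direction is used neither again in its own
branch nor in the branches finished earlier. So a vertex of a later branch differs from r in its
root direction, where all vertices of earlier branches agree with r. -/
theorem Completable.finish_branches {N : ℕ} (ih : T.Completable S N) (h : T.Good S g P)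
    {L : Finset V} (hL : L ⊆ T.ch r) (hLP : L ⊆ P) (hN : ∀ l ∈ L, #(T.dsc l) ≤ N)
    (hdeep : ∀ w ∈ P, w ∈ T.branches L → T.dep w ≤ T.height w + T.dep r)
    (hup : ∀ l ∈ L, ∀ w ∈ P, w ∈ T.dsc l → ∀ t ∈ T.dsc l, t ∉ P →
      T.height t + T.dep w ≤ T.height w + T.dep t)
    (hinj : Set.InjOn g ↑(P ∩ T.branches L)) {A Φ : Finset ι} (hΦ : Φ ⊆ A)
    (hb : #P + #A + #(T.branches L \ P) ≤ k + 2)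
    (hb' : L.Nonempty → #P + #Φ + #(T.branches L \ P) ≤ k) :
    ∃ g' : V → ι, (∀ w ∈ P, g' w = g w) ∧ T.Good S g' (P ∪ T.branches L) ∧
      (∀ t ∈ T.branches L, t ∉ P → g' t ∉ Φ) ∧
      (∀ l ∈ L, ∀ t ∈ T.top l, t ∉ P → g' t ∉ A) ∧
      (∀ l ∈ L, Set.InjOn g' ↑(T.top l)) ∧
      (∀ l ∈ L, ∀ w ∈ T.dsc l, w ≠ l → g' w ≠ g' l) ∧
      Set.InjOn (T.pos S g') ↑(T.branches L) := by
  induction hM : #L generalizing g P L with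
  | zero =>
    rw [card_eq_zero] at hM
    subst hM
    exact ⟨g, fun _ _ => rfl, by simpa [branches] using h, by simp [branches], by simp, by simp,
      by simp, by simp [branches]⟩
  | succ M ihL =>
    have hLne : L.Nonempty := card_pos.1 (by omega)
    obtain ⟨j, hj⟩ := hLne
    have hbj := hb' ⟨j, hj⟩
    set L' := L.erase j with hL'
    have hL'L : L' ⊆ L := erase_subset j L
    have hcL : #L' + 1 = #L := card_erase_add_one hj
    have hjP := hLP hj
    have hjr := hL hj
    obtain ⟨hroot, hpar⟩ := mem_ch.1 hjr
    have hdj := dep_ch hjr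
    have hdisj : Disjoint (T.dsc j) (T.branches L') :=
      disjoint_dsc_branches (hL'L.trans hL) hjr (notMem_erase j L)
    have hbr : T.branches L = T.dsc j ∪ T.branches L' := branches_eq_union hj
    have hcb : #(T.branches L \ P) = #(T.dsc j \ P) + #(T.branches L' \ P) :=
      card_branches_sdiff_eq hL hj P
    -- Every remaining branch has at least as many unplaced vertices as placed ones, and its root is
    -- placed; this pays for reserving the root directions.
    have hpend : #L' ≤ #(T.branches L' \ P) := by
      rw [card_branches_sdiff (hL'L.trans hL), card_eq_sum_ones]
      refine Finset.sum_le_sum fun l hl => ?_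
      have h1 := card_inter_le_card_sdiff (hL (hL'L hl)) fun w hw hwd =>
        hdeep w hw (dsc_subset_branches (hL'L hl) hwd)
      have h2 : 0 < #(P ∩ T.dsc l) :=
        card_pos.2 ⟨l, mem_inter.2 ⟨hLP (hL'L hl), self_mem_dsc l⟩⟩
      omega
    have hjL := dsc_subset_branches (T := T) hj
    have hPtop : ∀ w ∈ P, w ∈ T.dsc j → w ∈ T.top j := by
      intro w hw hwd
      have := hdeep w hw (hjL hwd)
      exact mem_top.2 ⟨hwd, by omega⟩
    obtain ⟨g₁, hg₁, hgood₁, hinj₁, hA₁⟩ := h.fill_top hroot hjP (hup j hj)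
      (hinj.mono (inter_subset_inter_left hjL)) (A ∪ L'.image g) [] (Or.inr ⟨rfl, by
        have h1 := card_union_le A (L'.image g)
        have h2 := card_image_le (s := L') (f := g)
        omega⟩)
    set P₁ := P ∪ T.top j with hP₁
    have hP₁top : ∀ w ∈ P₁, w ∈ T.dsc j → w ∈ T.top j := by
      intro w hw hwd
      rcases mem_union.1 hw with hw | hw
      · exact hPtop w hw hwd
      · exact hw
    have hsub : ∀ t ∈ T.branches (T.ch j), t ∈ T.dsc j ∧ t ≠ j := fun t ht => mem_branches_ch.1 ht
    have hjP₁ : j ∈ P₁ := mem_union_left _ hjP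
    have hc₁ : #P₁ + #(T.dsc j \ P₁) = #P + #(T.dsc j \ P) :=
      card_add_card_sdiff_eq subset_union_left (union_subset_union_right top_subset)
    -- No walk is passed on: reserving the direction of j already keeps this branch away from r. The
    -- lower half avoids Φ and all root directions, but not A; the spare unit in `hb'` pays for the
    -- direction of j itself.
    obtain ⟨g₂, hg₂⟩ := ih j (T.ch j) [] (Φ ∪ L.image g) g₁ P₁
      { good := hgood₁
        mem := hjP₁
        subset := subset_rfl
        deep := fun w hw hwb => (mem_top.1 (hP₁top w hw (hsub w hwb).1)).2
        up := by
          intro w hw hwb t ht htP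
          have h1 := (mem_top.1 (hP₁top w hw (hsub w hwb).1)).2
          have h2 : ¬ T.dep t ≤ T.height t + T.dep j := fun h =>
            htP (mem_union_right _ (mem_top.2 ⟨(hsub t ht).1, h⟩))
          omega
        inj := hinj₁.mono (inter_subset_inter_left fun t ht => (hsub t ht).1)
        nodup := List.nodup_nil
        head := by simp
        compat := by simp
        budget := by
          have h1 : T.branches (T.ch j) \ P₁ = T.dsc j \ P₁ := by
            rw [dsc_eq_insert j, insert_sdiff_of_mem _ hjP₁]
          have h2 := card_union_le Φ (L.image g)
          have h3 := card_image_le (s := L) (f := g)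
          rw [h1]
          omega } (by
      have h1 := card_insert_of_notMem (T.notMem_branches_ch j)
      rw [← dsc_eq_insert] at h1
      have h2 := hN j hj
      omega)
    have hdP : P₁ ∪ T.branches (T.ch j) = P ∪ T.dsc j := by
      have h1 : P₁ ∪ T.branches (T.ch j) = P₁ ∪ T.dsc j := by
        rw [dsc_eq_insert j, union_insert, insert_eq_of_mem (mem_union_left _ hjP₁)]
      rw [h1, hP₁, union_assoc, union_eq_right.2 top_subset]
    have hgood₂ := hg₂.good
    rw [hdP] at hgood₂
    set P₂ := P ∪ T.dsc j with hP₂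
    have hPP₂ : ∀ w ∈ P₂, w ∈ T.branches L' → w ∈ P := by
      intro w hw hwb
      rcases mem_union.1 hw with hw | hw
      · exact hw
      · exact absurd hwb (disjoint_left.1 hdisj hw)
    have hg₂P : ∀ w ∈ P, g₂ w = g w := fun w hw => by
      rw [hg₂.agree w (mem_union_left _ hw), hg₁ w hw]
    have hsd : T.branches L' \ P₂ = T.branches L' \ P := by
      ext t
      simp only [mem_sdiff]
      exact and_congr_right fun ht =>
        not_congr ⟨fun h => hPP₂ t h ht, fun h => mem_union_left _ h⟩
    have hc₂ : #P₂ = #P + #(T.dsc j \ P) := by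
      rw [hP₂, ← union_sdiff_self_eq_union, card_union_of_disjoint disjoint_sdiff]
    obtain ⟨g₃, hg₃, hgood₃, hΦ₃, hA₃, htop₃, hown₃, hpos₃⟩ := ihL hgood₂ (hL'L.trans hL)
      (fun l hl => mem_union_left _ (hLP (hL'L hl))) (fun l hl => hN l (hL'L hl))
      (fun w hw hwb => hdeep w (hPP₂ w hw hwb) (branches_mono hL'L hwb))
      (fun l hl w hw hwl t htl ht => hup l (hL'L hl) w
        (hPP₂ w hw (dsc_subset_branches hl hwl)) hwl t htl fun h => ht (mem_union_left _ h))
      (by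
        intro x hx y hy hxy
        obtain ⟨hx, hxb⟩ := mem_inter.1 (mem_coe.1 hx)
        obtain ⟨hy, hyb⟩ := mem_inter.1 (mem_coe.1 hy)
        have hx := hPP₂ x hx hxb
        have hy := hPP₂ y hy hyb
        rw [hg₂P x hx, hg₂P y hy] at hxy
        exact hinj (mem_inter.2 ⟨hx, branches_mono hL'L hxb⟩)
          (mem_inter.2 ⟨hy, branches_mono hL'L hyb⟩) hxy)
      (by rw [hsd]; omega) (fun _ => by rw [hsd]; omega) (by omega)
    have hg₃P : ∀ w ∈ P, g₃ w = g w := fun w hw => by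
      rw [hg₃ w (mem_union_left _ hw), hg₂P w hw]
    have hg₃d : ∀ w ∈ T.dsc j, g₃ w = g₂ w := fun w hw => hg₃ w (mem_union_right _ hw)
    have hg₃t : ∀ w ∈ T.top j, g₃ w = g₁ w := fun w hw => by
      rw [hg₃d w (top_subset hw), hg₂.agree w (mem_union_right _ hw)]
    have hlow : ∀ w ∈ T.dsc j, w ∉ P₁ → g₃ w ∉ Φ ∧ ∀ l ∈ L, g₃ w ≠ g l := by
      intro w hw hwP
      have hwj : w ≠ j := by rintro rfl; exact hwP hjP₁
      have h1 := hg₂.avoid w (mem_branches_ch.2 ⟨hw, hwj⟩) hwP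
      rw [mem_union, not_or] at h1
      rw [hg₃d w hw]
      exact ⟨h1.1, fun l hl he => h1.2 (he ▸ mem_image_of_mem g hl)⟩
    have hnew : ∀ w ∈ T.top j, w ∉ P → g₃ w ∉ A ∧ ∀ l ∈ L', g₃ w ≠ g l := by
      intro w hw hwP
      have h1 := (hA₁ w hw hwP).1
      rw [mem_union, not_or] at h1
      rw [hg₃t w hw]
      exact ⟨h1.1, fun l hl he => h1.2 (he ▸ mem_image_of_mem g hl)⟩
    have hcross : ∀ w ∈ T.dsc j, ∀ l ∈ L', g₃ w ≠ g₃ l := by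
      intro w hw l hl
      have hlL := hL'L hl
      have hlP := hLP hlL
      rw [hg₃P l hlP]
      by_cases hwP : w ∈ P
      · rw [hg₃P w hwP]
        intro he
        have := hinj (mem_inter.2 ⟨hwP, hjL hw⟩)
          (mem_inter.2 ⟨hlP, dsc_subset_branches hlL (self_mem_dsc l)⟩) he
        subst this
        exact disjoint_left.1 hdisj hw (dsc_subset_branches hl (self_mem_dsc w))
      · by_cases hwt : w ∈ T.top j
        · exact (hnew w hwt hwP).2 l hl
        · exact (hlow w hw (by simp [hP₁, hwP, hwt])).2 l hlL
    refine ⟨g₃, hg₃P, ?_, ?_, ?_, ?_, ?_, ?_⟩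
    · rw [hbr, ← union_assoc]
      exact hgood₃
    · intro t ht htP
      rw [hbr, mem_union] at ht
      by_cases htd : t ∈ T.dsc j
      · by_cases htt : t ∈ T.top j
        · exact fun hm => (hnew t htt htP).1 (hΦ hm)
        · exact (hlow t htd (by simp [hP₁, htP, htt])).1
      · exact hΦ₃ t (ht.resolve_left htd) (by simp [hP₂, htP, htd])
    · intro l hl t ht htP
      by_cases hlj : l = j
      · subst hlj
        exact (hnew t ht htP).1
      · have hlL' : l ∈ L' := mem_erase.2 ⟨hlj, hl⟩
        exact hA₃ l hlL' t ht fun h =>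
          htP (hPP₂ t h (dsc_subset_branches hlL' (top_subset ht)))
    · intro l hl
      by_cases hlj : l = j
      · subst hlj
        have : Set.InjOn g₁ ↑(T.top l) := hinj₁.mono fun t ht =>
          mem_inter.2 ⟨mem_union_right _ ht, top_subset ht⟩
        exact this.congr fun w hw => (hg₃t w hw).symm
      · exact htop₃ l (mem_erase.2 ⟨hlj, hl⟩)
    · intro l hl w hw hwl
      by_cases hlj : l = j
      · subst hlj
        by_cases hwP : w ∈ P₁
        · have hwt := hP₁top w hwP hw
          rw [hg₃t w hwt, hg₃t l (self_mem_top l)]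
          exact fun he => hwl (hinj₁ (mem_inter.2 ⟨hwP, hw⟩)
            (mem_inter.2 ⟨hjP₁, self_mem_dsc l⟩) he)
        · rw [hg₃P l hjP]
          exact (hlow w hw hwP).2 l hl
      · exact hown₃ l (mem_erase.2 ⟨hlj, hl⟩) w hw hwl
    · have hpos : ∀ w ∈ T.dsc j, T.pos S g₃ w = T.pos S g₂ w := fun w hw =>
        pos_congr hgood₂.par_mem hg₃ (mem_union_right _ hw)
      have hj₃ : Set.InjOn (T.pos S g₃) ↑(T.dsc j) :=
        (injOn_dsc hg₂.inj fun t ht => hg₂.walk_ne t ht 0).congr fun w hw => (hpos w hw).symm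
      have hne : ∀ x ∈ T.dsc j, ∀ y ∈ T.branches L', T.pos S g₃ x ≠ T.pos S g₃ y := by
        intro x hx y hy he
        obtain ⟨l, hl, hyl⟩ := mem_branches.1 hy
        refine pos_apply_ne (S := S) (g := g₃) (hL (hL'L hl)) hyl (hown₃ l hl) ?_
        rw [← he]
        refine pos_apply_of_forall_ne_of_closed hjr subset_rfl (fun w hw => par_mem_dsc hw) ?_ hx
        exact fun w hw => hcross w hw l hl
      rw [hbr]
      intro x hx y hy hxy
      rcases mem_union.1 (mem_coe.1 hx) with hx | hx <;>
        rcases mem_union.1 (mem_coe.1 hy) with hy | hy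
      · exact hj₃ hx hy hxy
      · exact absurd hxy (hne x hx y hy)
      · exact absurd hxy.symm (hne y hy x hx)
      · exact hpos₃ hx hy hxy

/-! ### The two cases of the induction step -/

/-- If s is not tight, the unplaced part of its branch is at least as large as its top half, so the
other branches can avoid all directions of the top half. If s is the only branch, there is nothing
else to place. -/
theorem Completable.complete_of_not_tight {N : ℕ} (ih : T.Completable S N) {C : Finset V}
    {Δ : List ι} {Φ : Finset ι} (h : T.Ready S r C Δ Φ g P) (hN : #(T.branches C) ≤ N)
    (hs : s ∈ C) (hcase : ¬ T.Tight s ∨ C.erase s = ∅) :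
    ∃ g', T.Completes S r C Δ Φ g P g' := by
  have hsr := h.subset hs
  have hsC := dsc_subset_branches (T := T) hs
  have hds := dep_ch hsr
  obtain ⟨g₁, hg₁, hgood₁, hinj₁, hΔ₁, hnew₁⟩ := h.fill_top hs
  set O := T.branches (C.erase s) with hO
  set P₁ := P ∪ T.top s with hP₁
  have hdisj : Disjoint (T.dsc s) O :=
    disjoint_dsc_branches ((erase_subset s C).trans h.subset) hsr (notMem_erase s C)
  have hbr : T.branches C = T.dsc s ∪ O := branches_eq_union hs
  have hOC : O ⊆ T.branches C := branches_mono (erase_subset s C)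
  have hPtop : ∀ w ∈ P, w ∈ T.dsc s → w ∈ T.top s := by
    intro w hw hwd
    have := h.deep w hw (hsC hwd)
    exact mem_top.2 ⟨hwd, by omega⟩
  have hPO : ∀ w ∈ P₁, w ∈ O → w ∈ P := by
    intro w hw hwO
    rcases mem_union.1 hw with hw | hw
    · exact hw
    · exact absurd hwO (disjoint_left.1 hdisj (top_subset hw))
  have hsd₁ : T.dsc s \ P₁ = T.dsc s \ T.top s := by
    ext t
    simp only [hP₁, mem_sdiff, mem_union, not_or]
    exact ⟨fun h => ⟨h.1, h.2.2⟩, fun h => ⟨h.1, fun hP => h.2 (hPtop t hP h.1), h.2⟩⟩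
  have hOsd : O \ P₁ = O \ P := by
    ext t
    simp only [mem_sdiff]
    exact and_congr_right fun ht => not_congr ⟨fun h => hPO t h ht, fun h => mem_union_left _ h⟩
  have hc₁ : #P₁ + #(T.dsc s \ P₁) = #P + #(T.dsc s \ P) :=
    card_add_card_sdiff_eq subset_union_left (union_subset_union_right top_subset)
  have hbud := h.budget
  rw [card_branches_sdiff_eq h.subset hs, ← hO] at hbud
  have htopd : #(T.dsc s \ T.top s) + #(T.top s) = #(T.dsc s) :=
    card_sdiff_add_card_eq_card top_subset
  obtain ⟨g₂, hg₂⟩ : ∃ g₂,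
      T.Completes S r (C.erase s) Δ (Φ ∪ (T.top s).image g₁) g₁ P₁ g₂ := by
    rcases hcase with hnt | hemp
    · refine ih r (C.erase s) Δ _ g₁ P₁
        { good := hgood₁
          mem := mem_union_left _ h.mem
          subset := (erase_subset s C).trans h.subset
          deep := fun w hw hwO => h.deep w (hPO w hw hwO) (hOC hwO)
          up := fun w hw hwO t htO ht => h.up w (hPO w hw hwO) (hOC hwO) t (hOC htO)
            fun hP => ht (mem_union_left _ hP)
          inj := ?_
          nodup := h.nodup
          head := by rw [hg₁ r h.mem]; exact h.head
          compat := fun t ht htO => by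
            rw [hg₁ t (hPO t ht htO)]
            exact h.compat t (hPO t ht htO) (hOC htO)
          budget := ?_ } ?_
      · intro x hx y hy hxy
        obtain ⟨hx, hxO⟩ := mem_inter.1 (mem_coe.1 hx)
        obtain ⟨hy, hyO⟩ := mem_inter.1 (mem_coe.1 hy)
        have hx := hPO x hx hxO
        have hy := hPO y hy hyO
        rw [hg₁ x hx, hg₁ y hy] at hxy
        exact h.inj (mem_inter.2 ⟨hx, hOC hxO⟩) (mem_inter.2 ⟨hy, hOC hyO⟩) hxy
      · have h1 := card_union_le Φ ((T.top s).image g₁)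
        have h2 := card_image_le (s := T.top s) (f := g₁)
        rw [← hO, hOsd]
        rw [hsd₁] at hc₁
        unfold Tight at hnt
        omega
      · rw [hbr, card_union_of_disjoint hdisj] at hN
        have : 0 < #(T.dsc s) := card_pos.2 ⟨s, self_mem_dsc s⟩
        rw [← hO]
        omega
    · rw [hemp]
      exact ⟨g₁, fun _ _ => rfl, by simpa [branches] using hgood₁, by simp [branches],
        by simp [branches], by simp [branches]⟩
  set P₂ := P₁ ∪ O with hP₂
  have hPP₂ : P ⊆ P₂ := subset_union_left.trans subset_union_left
  have hP₂C : P₂ ⊆ P ∪ T.branches C := by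
    rw [hbr, hP₂, hP₁, union_assoc]
    exact union_subset_union_right (union_subset_union_left top_subset)
  have hc₂ := card_add_card_sdiff_eq hPP₂ hP₂C
  have hg₂P : ∀ w ∈ P, g₂ w = g w := fun w hw => by
    rw [hg₂.agree w (mem_union_left _ hw), hg₁ w hw]
  have hg₂t : ∀ w ∈ T.top s, g₂ w = g₁ w := fun w hw => hg₂.agree w (mem_union_right _ hw)
  have hinj₂ : Set.InjOn g₂ ↑(T.top s) := hinj₁.congr fun w hw => (hg₂t w hw).symm
  have hcross : ∀ w' ∈ O, ∀ w ∈ T.top s, g₂ w' ≠ g₂ w := by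
    intro w' hw' w hw
    by_cases hwP' : w' ∈ P
    · by_cases hwP : w ∈ P
      · rw [hg₂P w hwP, hg₂P w' hwP']
        intro he
        have := h.inj (mem_inter.2 ⟨hwP', hOC hw'⟩) (mem_inter.2 ⟨hwP, hsC (top_subset hw)⟩) he
        subst this
        exact disjoint_left.1 hdisj (top_subset hw) hw'
      · rw [hg₂t w hw, hg₂P w' hwP']
        exact ((hnew₁ w hw hwP).2 w' hwP' hw').symm
    · have h1 := hg₂.avoid w' hw' fun h => hwP' (hPO w' h hw')
      rw [mem_union, not_or] at h1
      rw [hg₂t w hw]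
      exact fun he => h1.2 (he ▸ mem_image_of_mem g₁ hw)
  obtain ⟨g₃, hg₃, hgood₃, hΦ₃, hinj₃, hwalk₃⟩ := ih.finish (P := P₂) hg₂.good hsr
    ((card_le_card hsC).trans hN) (by
      intro t ht htP
      rcases mem_union.1 htP with htP | htO
      · rcases mem_union.1 htP with htP | htt
        · exact hPtop t htP ht
        · exact htt
      · exact absurd htO (disjoint_left.1 hdisj ht))
    (subset_union_right.trans subset_union_left) hinj₂ h.nodup
    (fun t ht => by rw [hg₂t t ht]; exact hΔ₁ t ht) (Φ := Φ) (by
      have h1 := card_le_card (sdiff_subset_sdiff hsC (subset_refl P₂))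
      have h2 := h.budget
      omega)
    (O := O) subset_union_right (by
      intro b hb u hu
      refine lt_hammingDist_of_agree hsr hinj₂ ?_ (hg₂.walk_ne b hb 0) hu
      intro w hw
      obtain ⟨l, hl, hbl⟩ := mem_branches.1 hb
      exact pos_apply_of_forall_ne_of_closed (h.subset (mem_of_mem_erase hl)) subset_rfl
        (fun w hw => par_mem_dsc hw)
        (fun w' hw' => hcross w' (dsc_subset_branches hl hw') w hw) hbl)
    hg₂.inj hg₂.walk_ne
  refine ⟨g₃, fun w hw => by rw [hg₃ w (hPP₂ hw), hg₂P w hw], ?_, ?_, ?_, ?_⟩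
  · have : P ∪ T.branches C = P₂ ∪ T.dsc s := by
      refine subset_antisymm (union_subset (hPP₂.trans subset_union_left) ?_)
        (union_subset hP₂C (hsC.trans subset_union_right))
      rw [hbr]
      exact union_subset subset_union_right (subset_union_right.trans subset_union_left)
    rw [this]
    exact hgood₃
  · intro t ht htP
    rw [hbr] at ht
    by_cases htP₂ : t ∈ P₂
    · rw [hg₃ t htP₂]
      rcases mem_union.1 htP₂ with htP₁ | htO
      · have htt : t ∈ T.top s := (mem_union.1 htP₁).resolve_left htP
        rw [hg₂t t htt]
        exact (hnew₁ t htt htP).1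
      · have := hg₂.avoid t htO fun h => htP (hPO t h htO)
        exact fun hm => this (mem_union_left _ hm)
    · rcases mem_union.1 ht with ht | ht
      · exact hΦ₃ t ht htP₂
      · exact absurd (mem_union_right _ ht) htP₂
  · rw [hbr]
    exact hinj₃
  · rw [hbr]
    exact hwalk₃

/-- Short prefixes of the walk keep coordinate `g l`, which the branch changes once for all; long
ones end farther from r than the branch reaches. -/
theorem branch_walk_ne {l b : V} (hl : l ∈ T.ch r) (hb : b ∈ T.dsc l)
    (hown : ∀ w ∈ T.dsc l, w ≠ l → g w ≠ g l) {Δ : List ι} (hΔ : Δ.Nodup)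
    (hlΔ : g l ∉ Δ.take (T.height l + 1)) (j : ℕ) :
    T.pos S g b ≠ walk (T.pos S g r) (Δ.take j) := by
  intro he
  by_cases hj : (Δ.take j).length ≤ T.height l + 1
  · refine pos_apply_ne (S := S) hl hb hown ?_
    rw [he, walk_of_notMem]
    intro hm
    have h4 : Δ.take j = Δ.take (Δ.take j).length := by simp
    rw [h4] at hm
    exact hlΔ ((List.take_prefix_take_left hj).subset hm)
  · have h1 := hammingDist_walk (hΔ.sublist (List.take_sublist j Δ)) (T.pos S g r)
    have h2 := hammingDist_pos_le (S := S) (g := g) (dsc_trans hb (dsc_ch hl))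
    have h3 := dep_le_height hb
    have h4 := dep_ch hl
    rw [he] at h2
    omega

theorem dsc_eq_singleton (h : #(T.dsc s) ≤ 1) : T.dsc s = {s} := by
  have h1 : {s} ⊆ T.dsc s := singleton_subset_iff.2 (self_mem_dsc s)
  exact (eq_of_subset_of_card_le h1 (by simpa using h)).symm

theorem Completable.complete_of_tight {N : ℕ} (ih : T.Completable S N) {C : Finset V}
    {Δ : List ι} {Φ : Finset ι} (h : T.Ready S r C Δ Φ g P) (hN : #(T.branches C) ≤ N)
    (hs : s ∈ C) (htight : ∀ l ∈ C, T.Tight l) (hmax : ∀ l ∈ C, #(T.dsc l) ≤ #(T.dsc s)) :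
    ∃ g', T.Completes S r C Δ Φ g P g' := by
  have hsr := h.subset hs
  obtain ⟨hroot, hpar⟩ := mem_ch.1 hsr
  have hsC := dsc_subset_branches (T := T) hs
  have hds := dep_ch hsr
  obtain ⟨g₁, hg₁, hgood₁, hinj₁, hΔ₁, hnew₁⟩ := h.fill_top hs
  set O := T.branches (C.erase s) with hO
  set P₁ := P ∪ T.top s with hP₁
  have hCe : C.erase s ⊆ T.ch r := (erase_subset s C).trans h.subset
  have hdisj : Disjoint (T.dsc s) O := disjoint_dsc_branches hCe hsr (notMem_erase s C)
  have hbr : T.branches C = T.dsc s ∪ O := branches_eq_union hs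
  have hOC : O ⊆ T.branches C := branches_mono (erase_subset s C)
  have hPtop : ∀ w ∈ P, w ∈ T.dsc s → w ∈ T.top s := by
    intro w hw hwd
    have := h.deep w hw (hsC hwd)
    exact mem_top.2 ⟨hwd, by omega⟩
  have hPO : ∀ w ∈ P₁, w ∈ O → w ∈ P := by
    intro w hw hwO
    rcases mem_union.1 hw with hw | hw
    · exact hw
    · exact absurd hwO (disjoint_left.1 hdisj (top_subset hw))
  have hsd₁ : T.dsc s \ P₁ = T.dsc s \ T.top s := by
    ext t
    simp only [hP₁, mem_sdiff, mem_union, not_or]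
    exact ⟨fun h => ⟨h.1, h.2.2⟩, fun h => ⟨h.1, fun hP => h.2 (hPtop t hP h.1), h.2⟩⟩
  have htopd : #(T.dsc s \ T.top s) + #(T.top s) = #(T.dsc s) :=
    card_sdiff_add_card_eq_card top_subset
  have htops : #(T.dsc s) + 1 = 2 * #(T.top s) := by
    have h1 := htight s hs
    have h2 := T.two_mul_card_top_le s
    unfold Tight at h1
    omega
  have hc₁ : #P₁ + #(T.branches C \ P₁) = #P + #(T.branches C \ P) :=
    card_add_card_sdiff_eq subset_union_left (union_subset_union_right (top_subset.trans hsC))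
  set L := (C.erase s).filter fun l => 1 < #(T.dsc l) with hL
  set L₀ := (C.erase s).filter fun l => ¬ 1 < #(T.dsc l) with hL₀
  have hLe : L ⊆ C.erase s := filter_subset _ _
  have hL₀e : L₀ ⊆ C.erase s := filter_subset _ _
  have hLch : L ⊆ T.ch r := hLe.trans hCe
  have hL₀ch : L₀ ⊆ T.ch r := hL₀e.trans hCe
  have hLcard : ∀ l ∈ L, 1 < #(T.dsc l) := fun l hl => (mem_filter.1 hl).2
  have hleaf : ∀ l ∈ L₀, T.dsc l = {l} := fun l hl =>
    dsc_eq_singleton (not_lt.1 (mem_filter.1 hl).2)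
  have hbL₀ : T.branches L₀ = L₀ := by
    ext t
    rw [mem_branches]
    constructor
    · rintro ⟨l, hl, ht⟩
      rw [hleaf l hl, mem_singleton] at ht
      rwa [ht]
    · exact fun ht => ⟨t, ht, self_mem_dsc t⟩
  have hOsplit : O = T.branches L ∪ L₀ := by
    rw [hO, ← hbL₀, branches, branches, branches, ← union_biUnion, hL, hL₀,
      filter_union_filter_not_eq]
  have hLO : T.branches L ⊆ O := branches_mono hLe
  have hL₀O : L₀ ⊆ O := hOsplit ▸ subset_union_right
  have hLL₀ : Disjoint (T.branches L) L₀ := by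
    rw [disjoint_left]
    intro t ht ht₀
    obtain ⟨l, hl, htl⟩ := mem_branches.1 ht
    have hlt : l = t := eq_of_mem_dsc htl (self_mem_dsc t)
      (by rw [dep_ch (hLch hl), dep_ch (hL₀ch ht₀)])
    subst hlt
    exact (mem_filter.1 ht₀).2 (hLcard l hl)
  -- The other branches are split into those with several vertices and single leaves, which are
  -- placed after them: a leaf has no unplaced vertices to pay for its own early placement.
  have hcount : ∀ Q : Finset V,
      #(T.branches C \ Q) = #(T.dsc s \ Q) + #(T.branches L \ Q) + #(L₀ \ Q) := by
    intro Q
    rw [card_branches_sdiff_eq h.subset hs, ← hO, hOsplit, union_sdiff_distrib,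
      card_union_of_disjoint (hLL₀.mono sdiff_subset sdiff_subset), add_assoc]
  have hbud := h.budget
  set A := Φ ∪ (T.top s).image g₁ with hA
  have hAcard : #A ≤ #Φ + #(T.top s) :=
    (card_union_le _ _).trans (Nat.add_le_add_left card_image_le _)
  have htopA : ∀ w ∈ T.top s, g₁ w ∈ A := fun w hw =>
    mem_union_right _ (mem_image_of_mem g₁ hw)
  have hsP₁ : s ∈ P₁ := mem_union_right _ (self_mem_top s)
  have hrP₁ : r ∈ P₁ := mem_union_left _ h.mem
  have hdeep₁ : ∀ w ∈ P₁, w ∈ T.branches L → T.dep w ≤ T.height w + T.dep r :=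
    fun w hw hwb => h.deep w (hPO w hw (hLO hwb)) (hOC (hLO hwb))
  -- By tightness the unplaced part of s is one smaller than its top half, so forbidding A only fits
  -- a budget of k + 2. The missing unit is regained because `g₁ s` in A is free for children of r,
  -- and later because no walk is passed to the top halves.
  obtain ⟨g₂, hg₂, hgood₂, hinj₂, hA₂⟩ := hgood₁.place_branch_roots (Δ := Δ) (A := A) hrP₁ hLch
    hLcard hdeep₁ (by
      intro x hx y hy hxy
      obtain ⟨hx, hxb⟩ := mem_inter.1 (mem_coe.1 hx)
      obtain ⟨hy, hyb⟩ := mem_inter.1 (mem_coe.1 hy)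
      have hx := hPO x hx (hLO hxb)
      have hy := hPO y hy (hLO hyb)
      rw [hg₁ x hx, hg₁ y hy] at hxy
      exact h.inj (mem_inter.2 ⟨hx, hOC (hLO hxb)⟩) (mem_inter.2 ⟨hy, hOC (hLO hyb)⟩) hxy)
    (by rw [hg₁ r h.mem]; exact h.head) hsr hsP₁ (htopA s (self_mem_top s)) (by
      have h1 := hcount P₁
      rw [hsd₁] at h1
      omega)
  set P₂ := P₁ ∪ L with hP₂
  have hLb : L ⊆ T.branches L := fun l hl => mem_branches.2 ⟨l, hl, self_mem_dsc l⟩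
  have hP₂s : T.dsc s \ P₂ = T.dsc s \ T.top s := by
    rw [← hsd₁]
    ext t
    simp only [hP₂, mem_sdiff, mem_union, not_or]
    exact ⟨fun h => ⟨h.1, h.2.1⟩, fun h => ⟨h.1, h.2, fun hL =>
      disjoint_left.1 hdisj h.1 (hLO (hLb hL))⟩⟩
  have hc₂ : #P₂ + #(T.branches C \ P₂) = #P₁ + #(T.branches C \ P₁) :=
    card_add_card_sdiff_eq subset_union_left
      (union_subset_union_right ((hLb.trans hLO).trans hOC))
  have hP₂P : ∀ w ∈ P₂, w ∈ T.branches L → w ∈ P ∨ (w ∉ P₁ ∧ w ∈ L) := by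
    intro w hw hwb
    by_cases hwP : w ∈ P₁
    · exact Or.inl (hPO w hwP (hLO hwb))
    · exact Or.inr ⟨hwP, (mem_union.1 hw).resolve_left hwP⟩
  obtain ⟨g₃, hg₃, hgood₃, hΦ₃, hA₃, htop₃, hown₃, hpos₃⟩ := ih.finish_branches (A := A) (Φ := Φ)
    hgood₂ hLch subset_union_right
    (fun l hl => (card_le_card (dsc_subset_branches (mem_of_mem_erase (hLe hl)))).trans hN) (by
      intro w hw hwb
      rcases hP₂P w hw hwb with hwP | ⟨-, hwL⟩
      · exact h.deep w hwP (hOC (hLO hwb))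
      · have := dep_ch (hLch hwL)
        have := one_le_height (hLcard w hwL)
        omega) (by
      intro l hl w hw hwl t htl ht
      rcases hP₂P w hw (dsc_subset_branches hl hwl) with hwP | ⟨-, hwL⟩
      · exact h.up w hwP (hOC (hLO (dsc_subset_branches hl hwl))) t
          (hOC (hLO (dsc_subset_branches hl htl)))
          fun htP => ht (mem_union_left _ (mem_union_left _ htP))
      · have hlw : l = w := eq_of_mem_dsc hwl (self_mem_dsc w)
          (by rw [dep_ch (hLch hl), dep_ch (hLch hwL)])
        subst hlw
        have := dep_add_height_le htl
        have := dep_le htl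
        omega) hinj₂ subset_union_left (by
      have h1 := hcount P₂
      rw [hP₂s] at h1
      omega) (by
      -- Here the maximality of s is used: the branch of s has more than one vertex, hence by
      -- tightness at least three, and one of its unplaced vertices is the spare unit.
      rintro ⟨l, hl⟩
      have h1 := hcount P₂
      rw [hP₂s] at h1
      have h2 := hmax l (mem_of_mem_erase (hLe hl))
      have h3 := hLcard l hl
      omega)
  set P₃ := P₂ ∪ T.branches L with hP₃
  have hc₃ : #P₃ + #(T.branches C \ P₃) = #P₂ + #(T.branches C \ P₂) :=
    card_add_card_sdiff_eq subset_union_left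
      (union_subset_union_right (hLO.trans hOC))
  have hP₃s : T.dsc s \ P₃ = T.dsc s \ T.top s := by
    rw [← hP₂s]
    ext t
    simp only [hP₃, mem_sdiff, mem_union, not_or]
    exact ⟨fun h => ⟨h.1, h.2.1⟩, fun h => ⟨h.1, h.2, fun hL =>
      disjoint_left.1 hdisj h.1 (hLO hL)⟩⟩
  have hg₂₁ : ∀ w ∈ P₁, g₃ w = g₁ w := fun w hw => by
    rw [hg₃ w (mem_union_left _ hw), hg₂ w hw]
  have hP₁₃ : P₁ ⊆ P₃ := subset_union_left.trans subset_union_left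
  have hP₃P : ∀ w ∈ P₃, w ∈ O → w ∉ T.branches L → w ∈ P := by
    intro w hw hwO hwL
    rcases mem_union.1 hw with hw | hw
    · rcases mem_union.1 hw with hw | hw
      · exact hPO w hw hwO
      · exact absurd (hLb hw) hwL
    · exact absurd hw hwL
  -- The condition `deep` forbids early placement of a child of r with height 0.
  have hL₀P : ∀ l ∈ L₀, l ∉ P₃ := by
    intro l hl hlP
    have h1 := h.deep l (hP₃P l hlP (hL₀O hl) fun hb => disjoint_left.1 hLL₀ hb hl)
      (hOC (hL₀O hl))
    have h2 := dep_ch (hL₀ch hl)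
    have h3 := T.height_lt_card l
    rw [hleaf l hl, card_singleton] at h3
    omega
  obtain ⟨g₄, hg₄, hgood₄, hA₄⟩ := hgood₃.place_leaves (A := A) (hP₁₃ hrP₁) hL₀ch hsr (hP₁₃ hsP₁)
    (by rw [hg₂₁ s hsP₁]; exact htopA s (self_mem_top s)) (by
      have h1 := hcount P₃
      rw [hP₃s] at h1
      omega)
  set P₄ := P₃ ∪ L₀ with hP₄
  have hc₄ : #P₄ + #(T.branches C \ P₄) = #P₃ + #(T.branches C \ P₃) :=
    card_add_card_sdiff_eq subset_union_left
      (union_subset_union_right (hL₀O.trans hOC))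
  have hPP₁ : P ⊆ P₁ := subset_union_left
  have hP₁₄ : P₁ ⊆ P₄ := hP₁₃.trans subset_union_left
  have hOP₄ : O ⊆ P₄ := by
    rw [hOsplit]
    exact union_subset (subset_union_right.trans subset_union_left) subset_union_right
  have hP₄C : P₄ ⊆ P₁ ∪ O := by
    refine union_subset (union_subset (union_subset subset_union_left ?_) ?_) ?_
    · exact (hLb.trans hLO).trans subset_union_right
    · exact hLO.trans subset_union_right
    · exact hL₀O.trans subset_union_right
  have hg₄₁ : ∀ w ∈ P₁, g₄ w = g₁ w := fun w hw => by
    rw [hg₄ w (hP₁₃ hw), hg₂₁ w hw]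
  have hg₄P : ∀ w ∈ P, g₄ w = g w := fun w hw => by rw [hg₄₁ w (hPP₁ hw), hg₁ w hw]
  have hg₄t : ∀ w ∈ T.top s, g₄ w = g₁ w := fun w hw => hg₄₁ w (mem_union_right _ hw)
  have hg₄b : ∀ w ∈ T.branches L, g₄ w = g₃ w := fun w hw => hg₄ w (mem_union_right _ hw)
  have hg₄L : ∀ l ∈ L, g₄ l = g₂ l := fun l hl => by
    rw [hg₄b l (hLb hl), hg₃ l (mem_union_right _ hl)]
  have hinj₄ : Set.InjOn g₄ ↑(T.top s) := hinj₁.congr fun w hw => (hg₄t w hw).symm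
  have htop₄ : ∀ l ∈ L, Set.InjOn g₄ ↑(T.top l) := fun l hl =>
    (htop₃ l hl).congr fun w hw => (hg₄b w (dsc_subset_branches hl (top_subset hw))).symm
  have hown₄ : ∀ l ∈ C.erase s, ∀ w ∈ T.dsc l, w ≠ l → g₄ w ≠ g₄ l := by
    intro l hl w hw hwl
    by_cases hlL : 1 < #(T.dsc l)
    · have hl' : l ∈ L := mem_filter.2 ⟨hl, hlL⟩
      rw [hg₄b w (dsc_subset_branches hl' hw), hg₄b l (hLb hl')]
      exact hown₃ l hl' w hw hwl
    · rw [hleaf l (mem_filter.2 ⟨hl, hlL⟩), mem_singleton] at hw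
      exact absurd hw hwl
  have havoid : ∀ l ∈ C.erase s, ∀ w ∈ T.top l, w ∉ P → g₄ w ∉ A := by
    intro l hl w hw hwP
    by_cases hlL : 1 < #(T.dsc l)
    · have hl' : l ∈ L := mem_filter.2 ⟨hl, hlL⟩
      have hwb := dsc_subset_branches hl' (top_subset hw)
      rw [hg₄b w hwb]
      by_cases hwP₂ : w ∈ P₂
      · rcases hP₂P w hwP₂ hwb with hwP' | ⟨hwP₁, hwL⟩
        · exact absurd hwP' hwP
        · rw [hg₃ w hwP₂]
          exact (hA₂ w hwL hwP₁).1
      · exact hA₃ l hl' w hw hwP₂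
    · have hl' : l ∈ L₀ := mem_filter.2 ⟨hl, hlL⟩
      have hwl := top_subset hw
      rw [hleaf l hl', mem_singleton] at hwl
      subst hwl
      exact hA₄ w hl' (hL₀P w hl')
  have hcross : ∀ l ∈ C.erase s, ∀ w ∈ T.top s, ∀ w' ∈ T.top l, g₄ w ≠ g₄ w' := by
    intro l hl w hw w' hw'
    have hwO : w' ∈ O := dsc_subset_branches hl (top_subset hw')
    by_cases hwP' : w' ∈ P
    · by_cases hwP : w ∈ P
      · rw [hg₄P w hwP, hg₄P w' hwP']
        intro he
        have := h.inj (mem_inter.2 ⟨hwP, hsC (top_subset hw)⟩) (mem_inter.2 ⟨hwP', hOC hwO⟩) he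
        subst this
        exact disjoint_left.1 hdisj (top_subset hw) hwO
      · rw [hg₄t w hw, hg₄P w' hwP']
        exact (hnew₁ w hw hwP).2 w' hwP' hwO
    · intro he
      refine havoid l hl w' hw' hwP' ?_
      rw [← he, hg₄t w hw]
      exact htopA w hw
  have hΔ₄ : ∀ l ∈ C.erase s, g₄ l ∉ Δ.take (T.height l + 1) := by
    intro l hl
    have hlr := hCe hl
    by_cases hlP : l ∈ P
    · have h1 := h.compat l hlP (hOC (dsc_subset_branches hl (self_mem_dsc l)))
      have h2 := dep_ch hlr
      rwa [hg₄P l hlP, show T.height l + 1 = T.height l + 2 + T.dep r - T.dep l by omega]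
    · by_cases hlL : 1 < #(T.dsc l)
      · have hl' : l ∈ L := mem_filter.2 ⟨hl, hlL⟩
        rw [hg₄L l hl']
        refine (hA₂ l hl' fun hP => ?_).2
        exact hlP (hPO l hP (hLO (hLb hl')))
      · have hl' : l ∈ L₀ := mem_filter.2 ⟨hl, hlL⟩
        have h3 := T.height_lt_card l
        rw [hleaf l hl', card_singleton] at h3
        rw [show T.height l + 1 = 1 by omega]
        cases hΔ : Δ with
        | nil => simp
        | cons i Δ' =>
          obtain ⟨hr, hi⟩ := h.head i (by rw [hΔ]; rfl)
          rw [List.take_succ_cons, List.take_zero, List.mem_singleton, hi, ← hg₄P r h.mem]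
          exact hgood₄.child_ne_par hlr (mem_union_right _ hl') hr
  have hpos₄ : Set.InjOn (T.pos S g₄) ↑O := by
    have hb : Set.InjOn (T.pos S g₄) ↑(T.branches L) := hpos₃.congr fun w hw =>
      (pos_congr hgood₃.par_mem hg₄ (mem_union_right _ hw)).symm
    have hne : ∀ x ∈ T.branches L, ∀ y ∈ L₀, T.pos S g₄ x ≠ T.pos S g₄ y := by
      intro x hx y hy he
      obtain ⟨l, hl, hxl⟩ := mem_branches.1 hx
      refine pos_apply_ne (S := S) (g := g₄) (hLch hl) hxl (hown₄ l (hLe hl)) ?_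
      rw [he, pos_ch (hL₀ch hy), flip_of_ne]
      refine hgood₄.child_ne (hLch hl) (hL₀ch hy) (hOP₄ (hLO (hLb hl))) (hOP₄ (hL₀O hy)) ?_
      rintro rfl
      exact disjoint_left.1 hLL₀ (hLb hl) hy
    rw [hOsplit]
    intro x hx y hy hxy
    rcases mem_union.1 (mem_coe.1 hx) with hx | hx <;>
      rcases mem_union.1 (mem_coe.1 hy) with hy | hy
    · exact hb hx hy hxy
    · exact absurd hxy (hne x hx y hy)
    · exact absurd hxy.symm (hne y hy x hx)
    · by_contra hxyne
      rw [pos_ch (hL₀ch hx), pos_ch (hL₀ch hy)] at hxy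
      exact hgood₄.child_ne (hL₀ch hx) (hL₀ch hy) (hOP₄ (hL₀O hx)) (hOP₄ (hL₀O hy)) hxyne
        (flip_injective _ hxy)
  obtain ⟨g₅, hg₅, hgood₅, hΦ₅, hinj₅, hwalk₅⟩ := ih.finish (P := P₄) (Φ := Φ) hgood₄ hsr
    ((card_le_card hsC).trans hN) (by
      intro t ht htP
      rcases mem_union.1 (hP₄C htP) with htP | htO
      · rcases mem_union.1 htP with htP | htt
        · exact hPtop t htP ht
        · exact htt
      · exact absurd htO (disjoint_left.1 hdisj ht))
    (subset_union_right.trans hP₁₄) hinj₄ h.nodup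
    (fun t ht => by rw [hg₄t t ht]; exact hΔ₁ t ht) (by
      have h1 := card_le_card (sdiff_subset_sdiff hsC (subset_refl P₄))
      omega)
    (O := O) hOP₄ (by
      intro b hb u hu
      obtain ⟨l, hl, hbl⟩ := mem_branches.1 hb
      by_cases hlL : 1 < #(T.dsc l)
      · have hl' : l ∈ L := mem_filter.2 ⟨hl, hlL⟩
        exact lt_hammingDist_of_tight hsr (hCe hl) (htight l (mem_of_mem_erase hl)) hinj₄
          (htop₄ l hl') (hcross l hl) hbl hu
      · have hl' : l ∈ L₀ := mem_filter.2 ⟨hl, hlL⟩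
        rw [hleaf l hl', mem_singleton] at hbl
        subst hbl
        refine lt_hammingDist_of_agree hsr hinj₄ ?_ ?_ hu
        · intro w hw
          rw [pos_ch (hCe hl), flip_of_ne _ (hcross b hl w hw b (self_mem_top b))]
        · rw [pos_ch (hCe hl)]
          exact fun he => flip_self_ne _ _ (congrFun he (g₄ b)))
    hpos₄ (by
      intro b hb j
      obtain ⟨l, hl, hbl⟩ := mem_branches.1 hb
      exact branch_walk_ne (hCe hl) hbl (hown₄ l hl) h.nodup (hΔ₄ l hl) j)
  refine ⟨g₅, fun w hw => by rw [hg₅ w (hP₁₄ (hPP₁ hw)), hg₄P w hw], ?_, ?_, ?_, ?_⟩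
  · have : P ∪ T.branches C = P₄ ∪ T.dsc s := by
      refine subset_antisymm (union_subset ((hPP₁.trans hP₁₄).trans subset_union_left) ?_)
        (union_subset (hP₄C.trans (union_subset (union_subset subset_union_left ?_) ?_))
          (hsC.trans subset_union_right))
      · rw [hbr]
        exact union_subset subset_union_right (hOP₄.trans subset_union_left)
      · exact (top_subset.trans hsC).trans subset_union_right
      · exact hOC.trans subset_union_right
    rw [this]
    exact hgood₅
  · intro t ht htP
    rw [hbr] at ht
    by_cases htP₄ : t ∈ P₄
    · rw [hg₅ t htP₄]
      rcases mem_union.1 (hP₄C htP₄) with htP₁ | htO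
      · have htt : t ∈ T.top s := (mem_union.1 htP₁).resolve_left htP
        rw [hg₄t t htt]
        exact (hnew₁ t htt htP).1
      · obtain ⟨l, hl, htl⟩ := mem_branches.1 htO
        by_cases htt : t ∈ T.top l
        · exact fun hm => havoid l hl t htt htP (mem_union_left _ hm)
        · have htne : t ≠ l := by rintro rfl; exact htt (self_mem_top t)
          by_cases hlL : 1 < #(T.dsc l)
          · have hl' : l ∈ L := mem_filter.2 ⟨hl, hlL⟩
            have htb := dsc_subset_branches hl' htl
            rw [hg₄b t htb]
            refine hΦ₃ t htb fun htP₂ => ?_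
            rcases hP₂P t htP₂ htb with htP' | ⟨-, htL⟩
            · exact htP htP'
            · exact htne (eq_of_mem_dsc (self_mem_dsc t) htl
                (by rw [dep_ch (hLch hl'), dep_ch (hLch htL)]))
          · rw [hleaf l (mem_filter.2 ⟨hl, hlL⟩), mem_singleton] at htl
            exact absurd htl htne
    · rcases mem_union.1 ht with ht | ht
      · exact hΦ₅ t ht htP₄
      · exact absurd (hOP₄ ht) htP₄
  · rw [hbr]
    exact hinj₅
  · rw [hbr]
    exact hwalk₅

theorem completable (T : ParentTree V) (S : CubeColoring ι K k) (N : ℕ) : T.Completable S N := by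
  induction N with
  | zero => exact fun r C Δ Φ g P _ hN => absurd hN (Nat.not_lt_zero _)
  | succ N ih =>
    intro r C Δ Φ g P h hN
    have hN : #(T.branches C) ≤ N := by omega
    by_cases hcase : ∃ s ∈ C, ¬ T.Tight s ∨ C.erase s = ∅
    · obtain ⟨s, hs, hcase⟩ := hcase
      exact ih.complete_of_not_tight h hN hs hcase
    · push Not at hcase
      rcases C.eq_empty_or_nonempty with rfl | hC
      · exact ⟨g, fun _ _ => rfl, by simpa [branches] using h.good, by simp [branches],
          by simp [branches], by simp [branches]⟩
      · obtain ⟨s, hs, hmax⟩ := exists_max_image C (fun l => #(T.dsc l)) hC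
        exact ih.complete_of_tight h hN hs (fun l hl => (hcase l hl).1) hmax

theorem exists_good_injective [Nonempty ι] (T : ParentTree V) (S : CubeColoring ι K k)
    (hk : Fintype.card V ≤ k + 1) :
    ∃ g : V → ι, T.Good S g univ ∧ Function.Injective (T.pos S g) := by
  have hb : T.dsc T.root = univ := eq_univ_of_forall mem_dsc_root
  have hroot : ∀ t ∈ ({T.root} : Finset V), t ∈ T.branches (T.ch T.root) → False := by
    intro t ht hb
    rw [mem_singleton] at ht
    exact (mem_branches_ch.1 hb).2 ht
  have hins : {T.root} ∪ T.branches (T.ch T.root) = univ := by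
    rw [singleton_union, ← dsc_eq_insert, hb]
  -- At the root there is no walk and nothing is forbidden. The initial directions are arbitrary:
  -- only the root is placed, and its own direction plays no role.
  obtain ⟨g, hg⟩ := T.completable S _ T.root (T.ch T.root) [] ∅ (fun _ => Classical.arbitrary ι)
    {T.root}
    { good :=
        { root_mem := mem_singleton_self _
          par_mem := fun t ht => by rw [mem_singleton] at ht ⊢; rw [ht, T.par_root]
          edge := fun t ht hr => absurd (mem_singleton.1 ht) hr
          rainbow := fun t ht hr => absurd (mem_singleton.1 ht) hr }
      mem := mem_singleton_self _
      subset := subset_rfl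
      deep := fun w hw hb => (hroot w hw hb).elim
      up := fun w hw hb => (hroot w hw hb).elim
      inj := fun x hx => by
        obtain ⟨hx, hb⟩ := mem_inter.1 (mem_coe.1 hx)
        exact (hroot x hx hb).elim
      nodup := List.nodup_nil
      head := by simp
      compat := fun w hw hb => (hroot w hw hb).elim
      budget := by
        have h1 : #({T.root} ∪ T.branches (T.ch T.root)) = Fintype.card V := by
          rw [hins, card_univ]
        rw [← union_sdiff_self_eq_union, card_union_of_disjoint disjoint_sdiff] at h1
        rw [card_empty]
        omega } (Nat.lt_succ_self _)
  have hgood := hg.good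
  rw [hins] at hgood
  refine ⟨g, hgood, ?_⟩
  have := injOn_dsc hg.inj fun t ht => hg.walk_ne t ht 0
  rwa [hb, coe_univ, Set.injOn_univ] at this

end ParentTree

/-! ### From graphs in the hypercube to colorings by position and direction -/

theorem hypercube_adj_iff {n : ℕ} {x y : Fin n → ZMod 2} :
    (hypercube n).Adj x y ↔ ∃ i, y = flip x i := by
  have h2 : ∀ a b : ZMod 2, a ≠ b → b = a + 1 := by decide
  constructor
  · rintro ⟨i, hi, hu⟩
    refine ⟨i, funext fun j => ?_⟩
    by_cases hj : j = i
    · subst hj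
      rw [flip_self]
      exact h2 _ _ hi
    · rw [flip_of_ne _ hj]
      by_contra h
      exact hj (hu j (Ne.symm h))
  · rintro ⟨i, rfl⟩
    refine ⟨i, (flip_self_ne x i).symm, fun j hj => ?_⟩
    by_contra h
    exact hj (flip_of_ne x h).symm

theorem hypercube_adj_flip {n : ℕ} (x : Fin n → ZMod 2) (i : Fin n) :
    (hypercube n).Adj x (flip x i) := hypercube_adj_iff.2 ⟨i, rfl⟩

namespace CubeColoring

variable {n : ℕ} {Y C : Type*} {H : SimpleGraph Y} {c : H.EdgeLabeling C}

open Classical in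
/-- The color of the edge of `H` from `φ a` to `φ b = flip (φ a) i`, as a function of `φ a`
and `i`. -/
noncomputable def colorOf (φ : Y → Fin n → ZMod 2) (c : H.EdgeLabeling C) (x : Fin n → ZMod 2)
    (i : Fin n) : Option C :=
  -- The value `none` away from the edges makes the function total even when `C` is empty.
  if h : ∃ κ, ∃ a b, ∃ hab : H.Adj a b, φ a = x ∧ φ b = flip x i ∧ c.get a b hab = κ
  then some h.choose else none

theorem colorOf_eq {φ : Y → Fin n → ZMod 2} (hφ : Function.Injective φ) {a b : Y}
    (hab : H.Adj a b) {i : Fin n} (hb : φ b = flip (φ a) i) :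
    colorOf φ c (φ a) i = some (c.get a b hab) := by
  have h : ∃ κ, ∃ a' b', ∃ hab : H.Adj a' b',
      φ a' = φ a ∧ φ b' = flip (φ a) i ∧ c.get a' b' hab = κ := ⟨_, a, b, hab, rfl, hb, rfl⟩
  rw [colorOf, dif_pos h]
  obtain ⟨a', b', hab', ha', hb', hc⟩ := h.choose_spec
  rw [← hc]
  have h1 := hφ ha'
  have h2 := hφ (hb'.trans hb.symm)
  subst h1 h2
  rfl

/-- The edge-colored subgraph of the cube given by a properly edge-colored graph `H` of minimum
degree at least `k` that is embedded in the cube. -/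
noncomputable def ofEmbedding [Finite Y] (φ : Y → Fin n → ZMod 2) (hφ : Function.Injective φ)
    (hadj : ∀ a b, H.Adj a b → (hypercube n).Adj (φ a) (φ b)) (hc : IsProper c) {k : ℕ}
    (hk : ∀ y, k ≤ (H.neighborSet y).ncard) (y₀ : Y) : CubeColoring (Fin n) (Option C) k :=
  have hdeg : ∀ y, k ≤ {i | ∃ a b, φ a = φ y ∧ φ b = flip (φ y) i ∧ H.Adj a b}.ncard := by
    intro y
    have hsub : φ '' H.neighborSet y ⊆
        flip (φ y) '' {i | ∃ a b, φ a = φ y ∧ φ b = flip (φ y) i ∧ H.Adj a b} := by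
      rintro _ ⟨b, hb, rfl⟩
      obtain ⟨i, hi⟩ := hypercube_adj_iff.1 (hadj y b hb)
      exact ⟨i, ⟨y, b, rfl, hi, hb⟩, hi.symm⟩
    refine (hk y).trans ?_
    rw [← Set.ncard_image_of_injective _ hφ]
    exact (Set.ncard_le_ncard hsub).trans (Set.ncard_image_le (Set.toFinite _))
  { start := φ y₀
    edge := fun x i => ∃ a b, φ a = x ∧ φ b = flip x i ∧ H.Adj a b
    color := colorOf φ c
    edge_flip := by
      rintro x i ⟨a, b, rfl, hb, hab⟩
      exact ⟨b, a, hb, by rw [flip_flip], hab.symm⟩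
    color_flip := by
      rintro x i ⟨a, b, rfl, hb, hab⟩
      rw [colorOf_eq hφ hab hb, ← hb, colorOf_eq hφ hab.symm (by rw [hb, flip_flip]),
        SimpleGraph.EdgeLabeling.get_comm]
    proper := by
      rintro x i j ⟨a, b, rfl, hb, hab⟩ ⟨a', b', ha', hb', hab'⟩ he
      have := hφ ha'
      subst this
      rw [colorOf_eq hφ hab hb, colorOf_eq hφ hab' hb', Option.some.injEq] at he
      by_contra hne
      refine hc ⟨s(a', b), hab⟩ ⟨s(a', b'), hab'⟩ ?_ ⟨a', by simp, by simp⟩ he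
      intro h
      have h := Sym2.congr_right.1 (Subtype.mk.inj h)
      subst h
      exact hne (flip_injective _ (hb.symm.trans hb'))
    le_degree_start := hdeg y₀
    le_degree := by
      rintro x i ⟨a, b, rfl, -, -⟩
      exact hdeg a }

end CubeColoring

/-! ### Trees as rooted trees, and the rainbow copy -/

variable {V : Type*} {T : SimpleGraph V}

theorem exists_adj_dist_add_one (hT : T.Connected) (r : V) {t : V} (h : t ≠ r) :
    ∃ u, T.Adj u t ∧ T.dist r t = T.dist r u + 1 := by
  obtain ⟨p, hp⟩ := hT.exists_walk_length_eq_dist t r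
  cases p with
  | nil => exact absurd rfl h
  | @cons _ u _ hadj q =>
    refine ⟨u, hadj.symm, ?_⟩
    have h1 := SimpleGraph.dist_le q
    rw [SimpleGraph.Walk.length_cons] at hp
    have h2 := hT.dist_triangle (u := r) (v := u) (w := t)
    rw [SimpleGraph.dist_eq_one_iff_adj.2 hadj.symm] at h2
    have h3 := SimpleGraph.dist_comm (G := T) (u := t) (v := r)
    have h4 := SimpleGraph.dist_comm (G := T) (u := u) (v := r)
    omega

open Classical in
/-- A tree with a chosen root. -/
noncomputable def ParentTree.ofConnected (hT : T.Connected) (r : V) : ParentTree V where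
  root := r
  par t := if h : t = r then r else (exists_adj_dist_add_one hT r h).choose
  dep t := T.dist r t
  par_root := by simp
  dep_root := by simp
  dep_par t h := by
    rw [dif_neg h]
    exact (exists_adj_dist_add_one hT r h).choose_spec.2

theorem ParentTree.ofConnected_adj (hT : T.Connected) (r : V) {t : V} (h : t ≠ r) :
    T.Adj ((ParentTree.ofConnected hT r).par t) t := by
  simp only [ParentTree.ofConnected, dif_neg h]
  exact (exists_adj_dist_add_one hT r h).choose_spec.1

/-- The edges from non-root vertices to their parents are distinct, by depth, and a tree has exactly
as many edges as non-root vertices, so these are all of them. -/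
theorem ParentTree.ofConnected_exists [Finite V] (hT : T.IsTree) (r : V) {e : Sym2 V}
    (he : e ∈ T.edgeSet) :
    ∃ t, t ≠ r ∧ e = s((ParentTree.ofConnected hT.connected r).par t, t) := by
  classical
  have := Fintype.ofFinite V
  set R := ParentTree.ofConnected hT.connected r with hR
  let f : {t : V // t ≠ r} → T.edgeSet := fun t =>
    ⟨s(R.par t, t), ParentTree.ofConnected_adj hT.connected r t.2⟩
  have hf : Function.Injective f := by
    rintro ⟨a, ha⟩ ⟨b, hb⟩ hab
    have h := Subtype.mk.inj hab
    rw [Sym2.eq_iff] at h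
    rw [Subtype.mk.injEq]
    rcases h with h | h
    · exact h.2
    · have h1 := R.dep_par a ha
      have h2 := R.dep_par b hb
      simp only at h
      rw [h.1] at h1
      rw [← h.2] at h2
      omega
  have hcard : Nat.card T.edgeSet ≤ Nat.card {t : V // t ≠ r} := by
    have h1 := hT.card_edgeFinset
    rw [Nat.card_eq_fintype_card, Nat.card_eq_fintype_card, ← SimpleGraph.edgeFinset_card]
    have h2 : Fintype.card {t : V // t ≠ r} = Fintype.card V - 1 := by simp
    omega
  obtain ⟨t, ht⟩ := (hf.bijective_of_nat_card_le hcard).2 ⟨e, he⟩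
  exact ⟨t, t.2, (congrArg Subtype.val ht).symm⟩

theorem hasRainbowCopy_of_embedding {n : ℕ} {Y C : Type*} [Finite Y] {H : SimpleGraph Y}
    {c : H.EdgeLabeling C} (φ : Y → Fin n → ZMod 2) (hφ : Function.Injective φ)
    (hadj : ∀ a b, H.Adj a b → (hypercube n).Adj (φ a) (φ b)) (hc : IsProper c) {k : ℕ}
    (hk : ∀ y, k ≤ (H.neighborSet y).ncard) [Nonempty Y] [Finite V] (hT : T.IsTree)
    (hTk : T.edgeSet.ncard ≤ k) : HasRainbowCopy T c := by
  classical
  have := Fintype.ofFinite V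
  obtain ⟨y₀⟩ := ‹Nonempty Y›
  obtain ⟨r⟩ := hT.connected.nonempty
  have hV : Fintype.card V ≤ k + 1 := by
    rw [← hT.card_edgeFinset, SimpleGraph.edgeFinset_card, ← Nat.card_eq_fintype_card]
    exact Nat.succ_le_succ hTk
  -- In dimension 0 there is no direction to assign to the root; then k = 0 and the tree is a single
  -- vertex.
  rcases isEmpty_or_nonempty (Fin n) with hn | hn
  · have hk0 : k = 0 := by
      have h1 : H.neighborSet y₀ = ∅ := by
        refine Set.eq_empty_of_forall_notMem fun b hb => ?_
        obtain ⟨i, -⟩ := hadj _ _ hb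
        exact hn.elim i
      have h2 := hk y₀
      rwa [h1, Set.ncard_empty, Nat.le_zero] at h2
    have hsub : Subsingleton V := Fintype.card_le_one_iff_subsingleton.1 (by omega)
    have hno : ∀ a b, ¬ T.Adj a b := fun a b h => h.ne (Subsingleton.elim a b)
    refine ⟨⟨⟨fun _ => y₀, fun h => (hno _ _ h).elim⟩, fun a b _ => Subsingleton.elim a b⟩, ?_⟩
    rintro ⟨e, he⟩
    induction e using Sym2.inductionOn with
    | _ a b => exact (hno a b he).elim
  set R := ParentTree.ofConnected hT.connected r with hR
  set S := CubeColoring.ofEmbedding φ hφ hadj hc hk y₀ with hS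
  obtain ⟨g, hg, hinj⟩ := R.exists_good_injective S hV
  have hedge : ∀ t, t ≠ r → ∃ a b, φ a = R.pos S g (R.par t) ∧ φ b = R.pos S g t ∧ H.Adj a b := by
    intro t ht
    rw [ParentTree.pos_of_ne_root (T := R) (t := t) ht]
    exact hg.edge t (mem_univ t) ht
  have hex : ∀ t, ∃ y, φ y = R.pos S g t := by
    intro t
    by_cases ht : t = r
    · subst ht
      exact ⟨y₀, (ParentTree.pos_root (T := R) (S := S) (g := g)).symm⟩
    · obtain ⟨a, b, -, hb, -⟩ := hedge t ht
      exact ⟨b, hb⟩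
  choose f hf using hex
  have hfadj : ∀ t, t ≠ r → H.Adj (f (R.par t)) (f t) := by
    intro t ht
    obtain ⟨a, b, ha, hb, hab⟩ := hedge t ht
    rwa [← hφ (ha.trans (hf _).symm), ← hφ (hb.trans (hf _).symm)]
  have hfcol : ∀ t (ht : t ≠ r), S.color (R.pos S g (R.par t)) (g t) =
      some (c.get _ _ (hfadj t ht)) := by
    intro t ht
    rw [← hf]
    refine CubeColoring.colorOf_eq hφ (hfadj t ht) ?_
    rw [hf, hf]
    exact ParentTree.pos_of_ne_root (T := R) ht
  have hfinj : Function.Injective f := by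
    intro a b hab
    refine hinj ?_
    rw [← hf, ← hf, hab]
  refine ⟨⟨⟨f, ?_⟩, hfinj⟩, ?_⟩
  · intro a b hab
    obtain ⟨t, ht, he⟩ := ParentTree.ofConnected_exists hT r
      (show s(a, b) ∈ T.edgeSet from hab)
    rcases Sym2.eq_iff.1 he with ⟨rfl, rfl⟩ | ⟨rfl, rfl⟩
    · exact hfadj _ ht
    · exact (hfadj _ ht).symm
  · rintro ⟨e₁, he₁⟩ ⟨e₂, he₂⟩ he
    obtain ⟨t₁, ht₁, rfl⟩ := ParentTree.ofConnected_exists hT r he₁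
    obtain ⟨t₂, ht₂, rfl⟩ := ParentTree.ofConnected_exists hT r he₂
    have h1 : c.get _ _ (hfadj t₁ ht₁) = c.get _ _ (hfadj t₂ ht₂) := he
    have h2 := hg.rainbow t₁ (mem_univ _) ht₁ t₂ (mem_univ _) ht₂
      (by rw [hfcol t₁ ht₁, hfcol t₂ ht₂, h1])
    subst h2
    rfl

/-! ### Sharpness: the Cayley coloring -/

theorem isProper_cayleyColoring (n : ℕ) : IsProper (cayleyColoring n) := by
  rintro ⟨e₁, h₁⟩ ⟨e₂, h₂⟩ hne ⟨x, hx₁, hx₂⟩ he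
  obtain ⟨y, rfl⟩ := hx₁
  obtain ⟨z, rfl⟩ := hx₂
  obtain ⟨i, hi⟩ : ∃ i, y = flip x i := hypercube_adj_iff.1 h₁
  obtain ⟨j, hj⟩ : ∃ j, z = flip x j := hypercube_adj_iff.1 h₂
  subst hi hj
  refine hne ?_
  have h1 : (cayleyColoring n).get _ _ h₁ = i :=
    (cayleyColoring_get_eq_iff _ _).2 (flip_self_ne x i).symm
  have h2 : (cayleyColoring n).get _ _ h₂ = j :=
    (cayleyColoring_get_eq_iff _ _).2 (flip_self_ne x j).symm
  have : i = j := h1.symm.trans (Eq.trans he h2)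
  subst this
  rfl

theorem surjective_cayleyColoring (n : ℕ) : Function.Surjective (cayleyColoring n) := fun i =>
  ⟨⟨s(0, flip 0 i), hypercube_adj_flip 0 i⟩,
    (cayleyColoring_get_eq_iff (hypercube_adj_flip 0 i) i).2 (flip_self_ne 0 i).symm⟩

theorem degree_hypercube (n : ℕ) (x : Fin n → ZMod 2) : (hypercube n).degree x = n := by
  have : (hypercube n).neighborFinset x = univ.image (flip x) := by
    ext y
    simp [hypercube_adj_iff, eq_comm]
  rw [SimpleGraph.degree, this, card_image_of_injective _ (flip_injective x), card_univ,
    Fintype.card_fin]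

theorem minDegree_hypercube (n : ℕ) : (hypercube n).minDegree = n := by
  refine le_antisymm ?_ ?_
  · exact ((hypercube n).minDegree_le_degree 0).trans (degree_hypercube n 0).le
  · exact (hypercube n).le_minDegree_of_forall_le_degree n fun x => (degree_hypercube n x).ge

/-- Let i be the color of the closing edge. In a rainbow copy no other edge changes coordinate i, so
following the remaining path shows that the ends of the closing edge agree in coordinate i. -/
theorem not_hasRainbowCopy_cycleGraph (n : ℕ) {k : ℕ} (hk : 3 ≤ k) :
    ¬ HasRainbowCopy (SimpleGraph.cycleGraph k) (cayleyColoring n) := by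
  rintro ⟨f, hf⟩
  have hlast : (SimpleGraph.cycleGraph k).Adj ⟨k - 1, by omega⟩ ⟨0, by omega⟩ := by
    rw [SimpleGraph.cycleGraph_adj']
    right
    rw [Fin.sub_def]
    simp only
    rw [Nat.add_zero, show k - (k - 1) = 1 by omega, Nat.mod_eq_of_lt (by omega)]
  have hadj : ∀ j (hj : j + 1 < k), (SimpleGraph.cycleGraph k).Adj ⟨j, by omega⟩ ⟨j + 1, hj⟩ :=
    fun j hj => SimpleGraph.pathGraph_le_cycleGraph (SimpleGraph.pathGraph_adj.2 (Or.inl rfl))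
  set i := (cayleyColoring n).get _ _ (f.toHom.map_adj hlast) with hi
  have hne := (cayleyColoring_get_eq_iff _ i).1 hi.symm
  have hstep : ∀ j (hj : j < k), f.toHom ⟨j, hj⟩ i = f.toHom ⟨0, by omega⟩ i := by
    intro j
    induction j with
    | zero => exact fun _ => rfl
    | succ j ih =>
      intro hj
      rw [← ih (by omega)]
      by_contra hcon
      have h1 := (cayleyColoring_get_eq_iff (f.toHom.map_adj (hadj j hj)) i).2 (Ne.symm hcon)
      have h2 := @hf ⟨s(_, _), hadj j hj⟩ ⟨s(_, _), hlast⟩ (h1.trans hi)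
      have h2 := Sym2.eq_iff.1 (Subtype.mk.inj h2)
      simp only [Fin.mk.injEq] at h2
      omega
  exact hne (hstep _ _)

theorem not_hasRainbowCopy_of_lt_ncard {n : ℕ} [Finite V] {H : SimpleGraph V}
    (hH : n < H.edgeSet.ncard) : ¬ HasRainbowCopy H (cayleyColoring n) := by
  rintro ⟨f, hf⟩
  have h1 := Nat.card_le_card_of_injective _ hf
  rw [Nat.card_eq_fintype_card (α := Fin n), Fintype.card_fin] at h1
  exact absurd hH (not_lt.2 h1)

end RainbowTree

theorem theorem1p2 (n : ℕ) :
    -- rainbow trees in arbitrary properly edge-colored subgraphs of the hypercube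
    (∀ (G : (RainbowTree.hypercube n).Subgraph) [Fintype G.verts] [DecidableRel G.coe.Adj],
      G.verts.Nonempty →
      ∀ (C : Type u) (c : G.coe.EdgeLabeling C), RainbowTree.IsProper c →
      ∀ (V : Type v) [Finite V] (T : SimpleGraph V), T.IsTree →
        T.edgeSet.ncard ≤ G.coe.minDegree → RainbowTree.HasRainbowCopy T c) ∧
    -- the hypercube itself
    (∀ (C : Type u) (c : (RainbowTree.hypercube n).EdgeLabeling C), RainbowTree.IsProper c →
      ∀ (V : Type v) [Finite V] (T : SimpleGraph V), T.IsTree →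
        T.edgeSet.ncard ≤ n → RainbowTree.HasRainbowCopy T c) ∧
    -- sharpness
    ((RainbowTree.hypercube n).minDegree = n ∧
      RainbowTree.IsProper (RainbowTree.cayleyColoring n) ∧
      Function.Surjective (RainbowTree.cayleyColoring n) ∧
      (∀ k : ℕ, 3 ≤ k →
        ¬ RainbowTree.HasRainbowCopy (SimpleGraph.cycleGraph k) (RainbowTree.cayleyColoring n)) ∧
      (∀ (V : Type v) [Finite V] (H : SimpleGraph V), n < H.edgeSet.ncard →
        ¬ RainbowTree.HasRainbowCopy H (RainbowTree.cayleyColoring n))) := by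

  have hdeg : ∀ {Y : Type} [Fintype Y] (H : SimpleGraph Y) [DecidableRel H.Adj] (y : Y),
      H.minDegree ≤ (H.neighborSet y).ncard := by
    intro Y _ H _ y
    rw [Set.ncard_eq_toFinset_card']
    exact H.minDegree_le_degree y
  refine ⟨?_, ?_, RainbowTree.minDegree_hypercube n, RainbowTree.isProper_cayleyColoring n,
    RainbowTree.surjective_cayleyColoring n,
    fun k hk => RainbowTree.not_hasRainbowCopy_cycleGraph n hk,
    fun V _ H hH => RainbowTree.not_hasRainbowCopy_of_lt_ncard hH⟩
  · intro G _ _ hne C c hc V _ T hT hTk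
    have : Nonempty G.verts := hne.to_subtype
    exact RainbowTree.hasRainbowCopy_of_embedding (fun y : G.verts => (y : Fin n → ZMod 2))
      Subtype.val_injective (fun a b h => G.adj_sub h) hc (hdeg G.coe) hT hTk
  · intro C c hc V _ T hT hTk
    rw [← RainbowTree.minDegree_hypercube n] at hTk
    exact RainbowTree.hasRainbowCopy_of_embedding id Function.injective_id (fun _ _ h => h) hc
      (hdeg (RainbowTree.hypercube n)) hT hTk
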